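/- Let $\mathbb O_s$ be the algebra of split octonions over $\mathbb R$, with scalar part $\operatorname{Re}$, and let $\operatorname{Im}\mathbb O_s$ be its $7$-dimensional space of imaginary elements. On $\operatorname{Im}\mathbb O_s$ consider the $3$-form $\Omega_0(p,q,r)=B(pq,r)$, where $B(p,q)=\operatorname{Re}(pq)$; equivalently $\Omega_0(p,q,r)=\operatorname{Re}((pq)r)$. A $3$-form $\Omega$ on $\mathbb R^7$ is called a (split) $G_2$-structure if $\Omega=\varphi^*\Omega_0$ for some linear isomorphism $\varphi:\mathbb R^7\to\operatorname{Im}\mathbb O_s$. Let $I\subset\mathbb R$ be an open interval and let $\gamma:I\to P^6=P(\mathbb R^7)$ be a smooth non-degenerate (immersed) curve: near every point of $I$ it has a smooth lift $v$ to $\mathbb R^7$, $\gamma=\langle v\rangle$, such that $v,v',\dots,v^{(6)}$ are linearly independent. Let $\gamma^{(j)}(t)$ be the osculating subspace spanned by $v(t),v'(t),\dots,v^{(j)}(t)$, and write $\gamma''=\gamma^{(2)}$. The curve is compatible with $\Omega$ if $\Omega(\gamma,\gamma'',\cdot)=0$, that is, $\Omega(a,b,w)=0$ for all $t\in I$, $a\in\gamma(t)$,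 $b\in\gamma''(t)$, $w\in\mathbb R^7$. Number the rows and columns of $7\times7$ matrices by $0,\dots,6$. Let $x=\sum_{i=0}^{5}E_{i+1,i}$, $h=\operatorname{diag}(6,4,2,0,-2,-4,-6)$, $y=\sum_{i=0}^{5}(i+1)(6-i)E_{i,i+1}$ be the standard basis of the irreducible $\mathfrak{sl}(2,\mathbb R)\subset\mathfrak{sl}(7,\mathbb R)$. A canonical frame of $\gamma$ (with respect to the parameter $t$) is a smooth map $F:I\to SL(7,\mathbb R)$ whose first column spans $\gamma(t)$ and which satisfies $$F^{-1}F'\equiv x+\sum_{i=3}^{7}\theta_i(t)\,y^{\,i-1}\pmod{\langle h,y\rangle}\qquad\text{for all }t\in I ;$$ the functions $\theta_3,\dots,\theta_7$ are the Wilczynski invariants of $\gamma$ in the parameter $t$. Then a canonical frame exists, so that the Wilczynski invariants are defined, and for the functions $\theta_3,\dots,\theta_7$ given by any canonical frame the following are equivalent: there is a $G_2$-structure $\Omega$ on $\mathbb R^7$ with which $\gamma$ is compatible; the Wilczynski invariants $\theta_3,\theta_4,\theta_5,\theta_7$ (all except $\theta_6$) vanish identically on $I$. -/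

import Mathlib

open scoped ContDiff LinearAlgebra.Projectivization Matrix

/-! ## Split octonions and the split `G₂` three-form -/

/-- The underlying vector space of the split octonions, in Zorn's vector-matrix model: the
quadruple `(a, u, v, b)` is the vector matrix with rows `a, u` and `v, b`. -/
abbrev SplitOct : Type := ℝ × (Fin 3 → ℝ) × (Fin 3 → ℝ) × ℝ

/-- Zorn's multiplication of vector matrices, which is the multiplication of split octonions. -/
def SplitOct.mul (p q : SplitOct) : SplitOct :=
  (p.1 * q.1 + p.2.1 ⬝ᵥ q.2.2.1,
    p.1 • q.2.1 + q.2.2.2 • p.2.1 - p.2.2.1 ⨯₃ q.2.2.1,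
    q.1 • p.2.2.1 + p.2.2.2 • q.2.2.1 + p.2.1 ⨯₃ q.2.1,
    p.2.2.2 * q.2.2.2 + p.2.2.1 ⬝ᵥ q.2.1)

/-- The scalar part of a split octonion; the unit is `(1, 0, 0, 1)`. -/
noncomputable def SplitOct.re : SplitOct →ₗ[ℝ] ℝ where
  toFun p := (p.1 + p.2.2.2) / 2
  map_add' p q := by simp only [Prod.fst_add, Prod.snd_add]; ring
  map_smul' c p := by
    simp only [Prod.smul_fst, Prod.smul_snd, smul_eq_mul, RingHom.id_apply]; ring

/-- The `7`-dimensional space of imaginary split octonions. -/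
noncomputable abbrev ImSplitOct : Submodule ℝ SplitOct := LinearMap.ker SplitOct.re

theorem SplitOct.add_mul (p q r : SplitOct) : mul (p + q) r = mul p r + mul q r := by
  simp only [mul, Prod.ext_iff, Prod.fst_add, Prod.snd_add, add_dotProduct, map_add,
    LinearMap.add_apply, smul_add, add_smul]
  refine ⟨by ring, by abel, by abel, by ring⟩

theorem SplitOct.mul_add (p q r : SplitOct) : mul p (q + r) = mul p q + mul p r := by
  simp only [mul, Prod.ext_iff, Prod.fst_add, Prod.snd_add, dotProduct_add, map_add,
    smul_add, add_smul]
  refine ⟨by ring, by abel, by abel, by ring⟩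

theorem SplitOct.smul_mul (c : ℝ) (p q : SplitOct) : mul (c • p) q = c • mul p q := by
  simp only [mul, Prod.ext_iff, Prod.smul_fst, Prod.smul_snd, smul_dotProduct, map_smul,
    LinearMap.smul_apply, smul_add, smul_sub, smul_eq_mul, smul_smul, mul_comm c]
  refine ⟨by ring, trivial, trivial, by ring⟩

theorem SplitOct.mul_smul (c : ℝ) (p q : SplitOct) : mul p (c • q) = c • mul p q := by
  simp only [mul, Prod.ext_iff, Prod.smul_fst, Prod.smul_snd, dotProduct_smul, map_smul,
    smul_add, smul_sub, smul_eq_mul, smul_smul, mul_comm c]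
  refine ⟨by ring, trivial, trivial, by ring⟩

theorem SplitOct.re_mul_mul_alt (p q : SplitOct) (hp : re p = 0) (hq : re q = 0) :
    re (mul (mul p p) q) = 0 ∧ re (mul (mul p q) q) = 0 ∧ re (mul (mul p q) p) = 0 := by
  obtain ⟨a, u, v, b⟩ := p
  obtain ⟨c, r, s, d⟩ := q
  simp only [re, LinearMap.coe_mk, AddHom.coe_mk] at hp hq
  obtain rfl : b = -a := by linarith
  obtain rfl : d = -c := by linarith
  refine ⟨?_, ?_, ?_⟩ <;>
  · simp only [re, LinearMap.coe_mk, AddHom.coe_mk, mul, dotProduct, Fin.sum_univ_three,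
      crossProduct, LinearMap.mk₂_apply, Pi.add_apply, Pi.sub_apply, Pi.smul_apply, smul_eq_mul,
      Matrix.cons_val_zero, Matrix.cons_val_one, Matrix.cons_val]
    ring

/-- The `3`-form `Ω(p, q, r) = B(p q, r)` on imaginary split octonions, where `B(p, q)` is the
scalar part of `p q`. As `r` is imaginary, this is the scalar part of `(p q) r`. -/
noncomputable def splitG2Form : ImSplitOct [⋀^Fin 3]→ₗ[ℝ] ℝ where
  toFun m := SplitOct.re (SplitOct.mul (SplitOct.mul (m 0) (m 1)) (m 2))
  map_update_add' m i p q := by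
    rename_i inst
    obtain rfl : inst = instDecidableEqFin 3 := Subsingleton.elim _ _
    fin_cases i <;> simp [SplitOct.add_mul, SplitOct.mul_add]
  map_update_smul' m i c p := by
    rename_i inst
    obtain rfl : inst = instDecidableEqFin 3 := Subsingleton.elim _ _
    fin_cases i <;> simp [SplitOct.smul_mul, SplitOct.mul_smul]
  map_eq_zero_of_eq' m i j hm hij := by
    have h (p q : ImSplitOct) := SplitOct.re_mul_mul_alt p q p.2 q.2
    fin_cases i <;> fin_cases j <;> simp_all

/-- A `3`-form on `ℝ⁷` is a (split) `G₂`-structure if some linear isomorphism from `ℝ⁷` to the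
imaginary split octonions pulls `splitG2Form` back to it. -/
def IsG2Structure (Ω : (Fin 7 → ℝ) [⋀^Fin 3]→ₗ[ℝ] ℝ) : Prop :=
  ∃ φ : (Fin 7 → ℝ) ≃ₗ[ℝ] ImSplitOct, Ω = splitG2Form.compLinearMap φ.toLinearMap

/-! ## Non-degenerate curves in `P⁶` -/

/-- `v` is a smooth lift to `ℝ⁷` of the parametrized curve `γ` over the set `J`. -/
def IsSmoothLift (γ : ℝ → ℙ ℝ (Fin 7 → ℝ)) (J : Set ℝ) (v : ℝ → Fin 7 → ℝ) : Prop :=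
  ContDiffOn ℝ ∞ v J ∧ ∀ t ∈ J, ∃ hv : v t ≠ 0, Projectivization.mk ℝ (v t) hv = γ t

/-- `γ` is a smooth non-degenerate curve in `P⁶` over the open set `I` of parameters: near every
point it has a smooth lift `v` such that `v, v', …, v⁽⁶⁾` form a basis of `ℝ⁷`. -/
def IsNondegenerateCurve (γ : ℝ → ℙ ℝ (Fin 7 → ℝ)) (I : Set ℝ) : Prop :=
  ∀ t ∈ I, ∃ (J : Set ℝ) (v : ℝ → Fin 7 → ℝ), IsOpen J ∧ t ∈ J ∧ IsSmoothLift γ J v ∧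
    ∀ s ∈ J, LinearIndependent ℝ fun i : Fin 7 => iteratedDeriv i v s

/-- The osculating subspace `γ⁽ʲ⁾(t)`, spanned by the derivatives of order at most `j` of lifts
of `γ` near `t`. All lifts span the same subspace. -/
def osculatingSpace (γ : ℝ → ℙ ℝ (Fin 7 → ℝ)) (j : ℕ) (t : ℝ) : Submodule ℝ (Fin 7 → ℝ) :=
  Submodule.span ℝ {w | ∃ (J : Set ℝ) (v : ℝ → Fin 7 → ℝ), IsOpen J ∧ t ∈ J ∧
    IsSmoothLift γ J v ∧ ∃ i ≤ j, w = iteratedDeriv i v t}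

/-- The curve `γ` is compatible with the `3`-form `Ω`: `Ω(γ, γ'', ·) = 0`. -/
def IsCompatible (γ : ℝ → ℙ ℝ (Fin 7 → ℝ)) (I : Set ℝ)
    (Ω : (Fin 7 → ℝ) [⋀^Fin 3]→ₗ[ℝ] ℝ) : Prop :=
  ∀ t ∈ I, ∀ a ∈ osculatingSpace γ 0 t, ∀ b ∈ osculatingSpace γ 2 t, ∀ w, Ω ![a, b, w] = 0

/-! ## Canonical frames and Wilczynski invariants -/

/-- The element `x` of the irreducible `sl₂` in `sl₇`: ones below the diagonal. -/
def sl2X : Matrix (Fin 7) (Fin 7) ℝ :=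
  Matrix.of fun i j => if (i : ℕ) = j + 1 then 1 else 0

/-- The element `h = diag(6, 4, …, -6)`. -/
def sl2H : Matrix (Fin 7) (Fin 7) ℝ :=
  Matrix.diagonal fun i => 6 - 2 * (i : ℝ)

/-- The element `y`, with entries `6, 10, 12, 12, 10, 6` above the diagonal. -/
def sl2Y : Matrix (Fin 7) (Fin 7) ℝ :=
  Matrix.of fun i j => if (j : ℕ) = i + 1 then ((i : ℝ) + 1) * (6 - i) else 0

/-- `F` is a canonical moving frame of the curve `γ` with respect to the given parameter, and the
functions `θ 3, …, θ 7` are the coefficients that it defines: `F` is a smooth function with values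
in `SL(7, ℝ)`, its first column spans `γ`, and
`F⁻¹ F' = x + θ₃ y² + θ₄ y³ + θ₅ y⁴ + θ₆ y⁵ + θ₇ y⁶` modulo `⟨h, y⟩`. -/
structure IsCanonicalFrame (γ : ℝ → ℙ ℝ (Fin 7 → ℝ)) (I : Set ℝ)
    (F : ℝ → Matrix (Fin 7) (Fin 7) ℝ) (θ : ℕ → ℝ → ℝ) : Prop where
  smooth : ∀ i j, ContDiffOn ℝ ∞ (fun t => F t i j) I
  det_eq_one : ∀ t ∈ I, (F t).det = 1
  lifts : ∀ t ∈ I, ∃ h0 : (fun i => F t i 0) ≠ 0,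
    Projectivization.mk ℝ (fun i => F t i 0) h0 = γ t
  structure_eq : ∀ t ∈ I, ∃ b c : ℝ, ∀ i j,
    HasDerivAt (fun s => F s i j)
      ((F t * (sl2X + b • sl2H + c • sl2Y +
        ∑ m ∈ Finset.Icc 3 7, θ m t • sl2Y ^ (m - 1))) i j) t

/-- The functions `θ 3, …, θ 7` are the Wilczynski invariants of the curve `γ` (with respect to
the given parameter). -/
def IsWilczynskiInvariants (γ : ℝ → ℙ ℝ (Fin 7 → ℝ)) (I : Set ℝ) (θ : ℕ → ℝ → ℝ) : Prop :=
  ∃ F : ℝ → Matrix (Fin 7) (Fin 7) ℝ, IsCanonicalFrame γ I F θ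

/-! The gauge group of upper triangular unipotent matrices acts on the frames adapted to a curve,
and a canonical frame is found superdiagonal by superdiagonal, because the powers of `y` span a
complement of the image of `ad x` in the upper triangular matrices.

The irreducible `SL₂` lies in the split `G₂`, so it preserves a `G₂`-structure `ω` on `ℝ⁷`. In a
canonical frame `F` with `A = F⁻¹ F'`, a constant form `Ω` becomes a curve `f = F^*Ω` of forms with
`f' = A ⋆ f`, where `⋆` is the infinitesimal action, and `Ω` is compatible with the curve if and
only if `f(e₀, e₁, ·) = 0`. Going through the components of `f` by increasing weight, the equation
shows that `f` is proportional to `ω`. Now `y^m ⋆ ω` for `m = 2, 3, 4, 6` is not in the image of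
`x`, as it pairs nontrivially with a lowest weight vector of `Λ³ ℝ⁷ = V₁₂ ⊕ V₈ ⊕ V₆ ⊕ V₄ ⊕ V₀`, and
this forces `θ₃ = θ₄ = θ₅ = θ₇ = 0`. In contrast `y⁵` lies in the Lie algebra of `G₂`, so that `θ₆`
is free, and if the other invariants vanish, then `A` takes values in this Lie algebra and the form
`(F⁻¹)^*ω` is constant. -/

section MovingFrames

open scoped Matrix.Norms.Operator

/-! ## Alternating forms along moving frames -/

section MatrixCalculus

variable {m n : Type*}

theorem contDiffOn_matrix [Fintype m] [Fintype n] {M : ℝ → Matrix m n ℝ} {I : Set ℝ} :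
    ContDiffOn ℝ ∞ M I ↔ ∀ i j, ContDiffOn ℝ ∞ (fun t => M t i j) I := by
  let e := (Matrix.ofLinearEquiv ℝ (m := m) (n := n) (α := ℝ)).symm.toContinuousLinearEquiv
  rw [← e.comp_contDiffOn_iff, contDiffOn_pi]
  exact forall_congr' fun i => contDiffOn_pi

theorem hasDerivAt_matrix [Finite m] [Finite n] {M : ℝ → Matrix m n ℝ} {M' : Matrix m n ℝ}
    {t : ℝ} :
    HasDerivAt M M' t ↔ ∀ i j, HasDerivAt (fun s => M s i j) (M' i j) t := by
  cases nonempty_fintype m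
  cases nonempty_fintype n
  let e := (Matrix.ofLinearEquiv ℝ (m := m) (n := n) (α := ℝ)).symm.toContinuousLinearEquiv
  trans HasDerivAt (e ∘ M) (e M') t
  · exact ⟨fun h => e.hasFDerivAt.comp_hasDerivAt t h,
      fun h => by simpa only [Function.comp_def] using! e.symm.hasFDerivAt.comp_hasDerivAt t h⟩
  · rw [hasDerivAt_pi]
    exact forall_congr' fun i => hasDerivAt_pi

theorem hasDerivAt_mulVec [Finite m] [Fintype n] {M : ℝ → Matrix m n ℝ} {M' : Matrix m n ℝ}
    {t : ℝ} (h : HasDerivAt M M' t) (v : n → ℝ) :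
    HasDerivAt (fun s => M s *ᵥ v) (M' *ᵥ v) t := by
  cases nonempty_fintype m
  exact hasDerivAt_pi.2 fun i => .fun_sum fun j _ => (hasDerivAt_matrix.1 h i j).mul_const _

variable [Fintype n] [DecidableEq n]

theorem contDiffOn_det {M : ℝ → Matrix n n ℝ} {I : Set ℝ} (h : ContDiffOn ℝ ∞ M I) :
    ContDiffOn ℝ ∞ (fun t => (M t).det) I := by
  simp only [Matrix.det_apply]
  exact ContDiffOn.sum fun σ _ =>
    (contDiffOn_prod fun i _ => contDiffOn_matrix.1 h _ _).const_smul _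

theorem contDiffOn_nonsing_inv {M : ℝ → Matrix n n ℝ} {I : Set ℝ} (h : ContDiffOn ℝ ∞ M I)
    (hM : ∀ t ∈ I, IsUnit (M t)) : ContDiffOn ℝ ∞ (fun t => (M t)⁻¹) I := by
  have := FiniteDimensional.complete ℝ (Matrix n n ℝ)
  intro t ht
  obtain ⟨u, hu⟩ := hM t ht
  have hinv := contDiffAt_ringInverse ℝ (n := ∞) u
  rw [hu] at hinv
  simpa only [Function.comp_def, Matrix.nonsing_inv_eq_ringInverse] using
    hinv.comp_contDiffWithinAt t (h t ht)

theorem hasDerivAt_nonsing_inv {M : ℝ → Matrix n n ℝ} {A : Matrix n n ℝ} {t : ℝ}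
    (h : HasDerivAt M (M t * A) t) (hM : IsUnit (M t)) :
    HasDerivAt (fun s => (M s)⁻¹) (-(A * (M t)⁻¹)) t := by
  have := FiniteDimensional.complete ℝ (Matrix n n ℝ)
  have hdet := (Matrix.isUnit_iff_isUnit_det _).1 hM
  obtain ⟨u, hu⟩ := hM
  have hinv := hasFDerivAt_ringInverse (𝕜 := ℝ) u
  rw [hu] at hinv
  have hcomp := hinv.comp_hasDerivAt t h
  simp only [Function.comp_def, ← Matrix.nonsing_inv_eq_ringInverse] at hcomp
  refine hcomp.congr_deriv ?_
  simp [Matrix.coe_units_inv, hu, ← mul_assoc, Matrix.nonsing_inv_mul _ hdet]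

end MatrixCalculus

section FormAction

variable {ι : Type*}

theorem continuous_multilinearMap [Finite ι] {E : Type*} [NormedAddCommGroup E] [NormedSpace ℝ E]
    [FiniteDimensional ℝ E] (f : MultilinearMap ℝ (fun _ : ι => E) ℝ) : Continuous f := by
  classical
  cases nonempty_fintype ι
  let b := Module.finBasis ℝ E
  have hb (m : ι → E) : f m = ∑ r : ι → Fin (Module.finrank ℝ E),
      (∏ i, b.equivFun (m i) (r i)) * f fun i => b (r i) := by
    calc f m = f fun i => ∑ j, b.equivFun (m i) j • b j := by simp only [b.sum_equivFun]
      _ = _ := by simp only [f.map_sum, f.map_smul_univ, smul_eq_mul]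
  rw [funext hb]
  have hcoord (i : ι) (j : Fin (Module.finrank ℝ E)) :
      Continuous fun m : ι → E => b.equivFun (m i) j :=
    (continuous_apply j).comp
      (b.equivFun.toLinearMap.continuous_of_finiteDimensional.comp (continuous_apply i))
  exact continuous_finsetSum _ fun r _ =>
    (continuous_finsetProd _ fun i _ => hcoord i (r i)).mul continuous_const

variable [Fintype ι] [DecidableEq ι]

theorem hasDerivAt_alternatingMap {E : Type*} [NormedAddCommGroup E] [NormedSpace ℝ E]
    [FiniteDimensional ℝ E] (Ω : E [⋀^ι]→ₗ[ℝ] ℝ) {g : ℝ → ι → E} {g' : ι → E} {t : ℝ}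
    (hg : ∀ i, HasDerivAt (fun s => g s i) (g' i) t) :
    HasDerivAt (fun s => Ω (g s)) (∑ i, Ω (Function.update (g t) i (g' i))) t := by
  have h := (HasFDerivAt.multilinear_comp
    (f := ⟨Ω.toMultilinearMap, continuous_multilinearMap _⟩)
    fun i => (hg i).hasFDerivAt).hasDerivAt
  refine h.congr_deriv ?_
  simp [ContinuousMultilinearMap.toContinuousLinearMap]

variable {n : Type*} [Fintype n]

/-- The infinitesimal action of matrices on alternating forms: the value at `v` of the form
obtained by letting a matrix act on `Ω` as a derivation. It is linear in the matrix. -/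
def formAction (Ω : (n → ℝ) [⋀^ι]→ₗ[ℝ] ℝ) (v : ι → n → ℝ) : Matrix n n ℝ →ₗ[ℝ] ℝ where
  toFun M := ∑ i, Ω (Function.update v i (M *ᵥ v i))
  map_add' M N := by
    simp only [Matrix.add_mulVec, AlternatingMap.map_update_add, Finset.sum_add_distrib]
  map_smul' c M := by
    simp only [Matrix.smul_mulVec, AlternatingMap.map_update_smul, RingHom.id_apply,
      Finset.smul_sum]

theorem formAction_apply (Ω : (n → ℝ) [⋀^ι]→ₗ[ℝ] ℝ) (v : ι → n → ℝ) (M : Matrix n n ℝ) :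
    formAction Ω v M = ∑ i, Ω (Function.update v i (M *ᵥ v i)) := rfl

theorem formAction_sub (Ω Ω' : (n → ℝ) [⋀^ι]→ₗ[ℝ] ℝ) (v : ι → n → ℝ) :
    formAction (Ω - Ω') v = formAction Ω v - formAction Ω' v := by
  ext1 M
  simp [formAction_apply]

theorem formAction_smul (c : ℝ) (Ω : (n → ℝ) [⋀^ι]→ₗ[ℝ] ℝ) (v : ι → n → ℝ) :
    formAction (c • Ω) v = c • formAction Ω v := by
  ext1 M
  simp [formAction_apply, Finset.mul_sum]

theorem hasDerivAt_form_mulVec (Ω : (n → ℝ) [⋀^ι]→ₗ[ℝ] ℝ) (v : ι → n → ℝ)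
    {F : ℝ → Matrix n n ℝ} {A : Matrix n n ℝ} {t : ℝ} (hF : HasDerivAt F (F t * A) t) :
    HasDerivAt (fun s => Ω fun i => F s *ᵥ v i)
      (formAction (Ω.compLinearMap (F t).mulVecLin) v A) t := by
  refine (hasDerivAt_alternatingMap Ω fun i => hasDerivAt_mulVec hF (v i)).congr_deriv ?_
  refine Finset.sum_congr rfl fun i _ => congrArg Ω ?_
  ext1 j
  obtain rfl | hj := eq_or_ne j i <;> simp [*]

variable [DecidableEq n]

theorem formAction_one (Ω : (n → ℝ) [⋀^ι]→ₗ[ℝ] ℝ) (v : ι → n → ℝ) :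
    formAction Ω v 1 = Fintype.card ι * Ω v := by
  simp [formAction_apply]

theorem hasDerivAt_form_nonsing_inv_mulVec (Ω : (n → ℝ) [⋀^ι]→ₗ[ℝ] ℝ) (v : ι → n → ℝ)
    {F : ℝ → Matrix n n ℝ} {A : Matrix n n ℝ} {t : ℝ} (hF : HasDerivAt F (F t * A) t)
    (hu : IsUnit (F t)) :
    HasDerivAt (fun s => Ω fun i => (F s)⁻¹ *ᵥ v i)
      (-formAction Ω (fun i => (F t)⁻¹ *ᵥ v i) A) t := by
  refine (hasDerivAt_alternatingMap Ω fun i =>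
    hasDerivAt_mulVec (hasDerivAt_nonsing_inv hF hu) (v i)).congr_deriv ?_
  rw [← map_neg]
  simp [formAction_apply, Matrix.neg_mulVec, AlternatingMap.map_update_neg]

theorem formAction_detRowAlternating_single (M : Matrix n n ℝ) :
    formAction Matrix.detRowAlternating (fun i => Pi.single i 1) M = M.trace := by
  refine Finset.sum_congr rfl fun i _ => ?_
  have hsingle : (1 : Matrix n n ℝ) = fun i => Pi.single i 1 := by
    ext i j
    exact Matrix.one_eq_pi_single
  calc Matrix.det (Matrix.updateRow (fun i => Pi.single i 1) i (M *ᵥ Pi.single i 1))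
      = (Matrix.updateRow 1 i (M.col i)).det := by
        rw [Matrix.mulVec_single_one, ← hsingle]
    _ = Matrix.cramer 1 (M.col i) i := by
      rw [← Matrix.transpose_one, Matrix.cramer_transpose_apply, Matrix.transpose_one]
    _ = M i i := by rw [Matrix.cramer_one]; rfl

theorem detRowAlternating_compLinearMap (M : Matrix n n ℝ) :
    Matrix.detRowAlternating.compLinearMap M.mulVecLin =
      M.det • (Matrix.detRowAlternating : (n → ℝ) [⋀^n]→ₗ[ℝ] ℝ) := by
  ext1 v
  have hv : (fun i => M *ᵥ v i) = Matrix.of v * Mᵀ := by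
    ext i j
    simp [Matrix.mul_apply, Matrix.mulVec, dotProduct, mul_comm]
  change Matrix.det (fun i => M *ᵥ v i) = M.det * Matrix.det (Matrix.of v)
  rw [hv, Matrix.det_mul, Matrix.det_transpose, mul_comm]

theorem hasDerivAt_det {F : ℝ → Matrix n n ℝ} {A : Matrix n n ℝ} {t : ℝ}
    (hF : HasDerivAt F (F t * A) t) :
    HasDerivAt (fun s => (F s).det) ((F t).det * A.trace) t := by
  have h := hasDerivAt_form_mulVec Matrix.detRowAlternating (fun i : n => Pi.single i 1) hF
  rw [detRowAlternating_compLinearMap, formAction_smul, LinearMap.smul_apply,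
    formAction_detRowAlternating_single] at h
  refine h.congr_of_eventuallyEq (.of_forall fun s => ?_)
  refine (Matrix.det_transpose (F s)).symm.trans (congrArg Matrix.det ?_)
  ext i j
  simp

end FormAction

/-! ## Normalized lifts -/

section IteratedDeriv

variable {E : Type*} [NormedAddCommGroup E] [NormedSpace ℝ E]

theorem contDiffOn_iteratedDeriv {v : ℝ → E} {J : Set ℝ} (hv : ContDiffOn ℝ ∞ v J)
    (hJ : IsOpen J) (i : ℕ) : ContDiffOn ℝ ∞ (iteratedDeriv i v) J := by
  induction i with
  | zero => simpa using hv
  | succ i ih => simpa only [iteratedDeriv_succ] using ih.deriv_of_isOpen hJ le_rfl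

theorem hasDerivAt_iteratedDeriv {v : ℝ → E} {J : Set ℝ} (hv : ContDiffOn ℝ ∞ v J)
    (hJ : IsOpen J) (i : ℕ) {t : ℝ} (ht : t ∈ J) :
    HasDerivAt (iteratedDeriv i v) (iteratedDeriv (i + 1) v t) t := by
  have h := (contDiffOn_iteratedDeriv hv hJ i).contDiffAt (hJ.mem_nhds ht)
  rw [iteratedDeriv_succ]
  exact (h.differentiableAt (by simp)).hasDerivAt

theorem iteratedDeriv_smul_eq_sum {μ : ℝ → ℝ} {v : ℝ → E} {J : Set ℝ} (hJ : IsOpen J)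
    (hμ : ContDiffOn ℝ ∞ μ J) (hv : ContDiffOn ℝ ∞ v J) (k : ℕ) {t : ℝ} (ht : t ∈ J) :
    iteratedDeriv k (μ • v) t = ∑ i ∈ Finset.range (k + 1),
      ((k.choose i : ℝ) * iteratedDeriv (k - i) μ t) • iteratedDeriv i v t := by
  have hk : (k : ℕ∞ω) ≤ ∞ := by exact_mod_cast le_top
  have h := iteratedDerivWithin_smul (Set.mem_univ t) uniqueDiffOn_univ
    ((hμ.contDiffAt (hJ.mem_nhds ht)).of_le hk).contDiffWithinAt
    ((hv.contDiffAt (hJ.mem_nhds ht)).of_le hk).contDiffWithinAt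
  simp only [iteratedDerivWithin_univ] at h
  rw [h, ← Finset.sum_range_reflect]
  refine Finset.sum_congr rfl fun i hi => ?_
  have hik : i ≤ k := Finset.mem_range_succ_iff.1 hi
  rw [show k + 1 - 1 - i = k - i by omega, Nat.choose_symm hik, Nat.sub_sub_self hik, mul_smul,
    Nat.cast_smul_eq_nsmul]

end IteratedDeriv

section Wronskian

variable {n : ℕ}

/-- The Wronskian matrix of a curve in `ℝⁿ`, with columns `v, v', …, v⁽ⁿ⁻¹⁾`. -/
noncomputable def wronskianMatrix (v : ℝ → Fin n → ℝ) (t : ℝ) : Matrix (Fin n) (Fin n) ℝ :=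
  Matrix.of fun i j => iteratedDeriv j v t i

theorem wronskianMatrix_congr {v w : ℝ → Fin n → ℝ} {t : ℝ} (h : v =ᶠ[nhds t] w) :
    wronskianMatrix v t = wronskianMatrix w t := by
  ext i j
  exact congrFun (h.iteratedDeriv_eq j) i

theorem contDiffOn_wronskianMatrix {v : ℝ → Fin n → ℝ} {J : Set ℝ} (hJ : IsOpen J)
    (hv : ContDiffOn ℝ ∞ v J) : ContDiffOn ℝ ∞ (wronskianMatrix v) J :=
  contDiffOn_matrix.2 fun i j => contDiffOn_pi.1 (contDiffOn_iteratedDeriv hv hJ j) i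

/-- The matrix of the Leibniz rule: it expresses the derivatives of `μ • v` through those of `v`. -/
noncomputable def leibnizMatrix (n : ℕ) (μ : ℝ → ℝ) (t : ℝ) : Matrix (Fin n) (Fin n) ℝ :=
  Matrix.of fun i j => if i ≤ j then ((j : ℕ).choose i : ℝ) * iteratedDeriv (j - i) μ t else 0

theorem wronskianMatrix_smul {μ : ℝ → ℝ} {v : ℝ → Fin n → ℝ} {J : Set ℝ} (hJ : IsOpen J)
    (hμ : ContDiffOn ℝ ∞ μ J) (hv : ContDiffOn ℝ ∞ v J) {t : ℝ} (ht : t ∈ J) :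
    wronskianMatrix (μ • v) t = wronskianMatrix v t * leibnizMatrix n μ t := by
  ext i j
  simp only [wronskianMatrix, leibnizMatrix, Matrix.of_apply, Matrix.mul_apply, Fin.le_def]
  rw [iteratedDeriv_smul_eq_sum hJ hμ hv j ht, Finset.sum_apply,
    Fin.sum_univ_eq_sum_range (fun l => iteratedDeriv l v t i *
      if l ≤ (j : ℕ) then ((j : ℕ).choose l : ℝ) * iteratedDeriv (j - l) μ t else 0) n,
    ← Finset.sum_subset (Finset.range_subset_range.2 j.isLt)]
  · refine Finset.sum_congr rfl fun l hl => ?_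
    rw [if_pos (Finset.mem_range_succ_iff.1 hl), Pi.smul_apply, smul_eq_mul, mul_comm]
  · intro l _ hl
    rw [if_neg (fun h => hl (Finset.mem_range_succ_iff.2 h)), mul_zero]

theorem det_leibnizMatrix (μ : ℝ → ℝ) (t : ℝ) : (leibnizMatrix n μ t).det = μ t ^ n := by
  have hT : (leibnizMatrix n μ t).IsUpperTriangular := fun _ _ h => if_neg (not_le.2 h)
  rw [Matrix.det_of_isUpperTriangular hT]
  simp [leibnizMatrix]

theorem det_wronskianMatrix_smul {μ : ℝ → ℝ} {v : ℝ → Fin n → ℝ} {J : Set ℝ} (hJ : IsOpen J)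
    (hμ : ContDiffOn ℝ ∞ μ J) (hv : ContDiffOn ℝ ∞ v J) {t : ℝ} (ht : t ∈ J) :
    (wronskianMatrix (μ • v) t).det = μ t ^ n * (wronskianMatrix v t).det := by
  rw [wronskianMatrix_smul hJ hμ hv ht, Matrix.det_mul, det_leibnizMatrix, mul_comm]

theorem exists_contDiffOn_pow_mul_eq_one (hn : Odd n) {f : ℝ → ℝ} {J : Set ℝ}
    (hf : ContDiffOn ℝ ∞ f J) (hf0 : ∀ t ∈ J, f t ≠ 0) :
    ∃ μ : ℝ → ℝ, ContDiffOn ℝ ∞ μ J ∧ ∀ t ∈ J, μ t ^ n * f t = 1 := by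
  obtain ⟨k, rfl⟩ := hn
  -- `f * (f ^ 2) ^ r` is the odd root `f ^ (-1 / n)`, including its sign
  let r : ℝ := -(k + 1) / (2 * k + 1)
  refine ⟨fun t => f t * (f t ^ 2) ^ r, hf.mul ((hf.pow 2).rpow_const_of_ne fun t ht =>
    pow_ne_zero 2 (hf0 t ht)), fun t ht => ?_⟩
  have hpos : 0 < f t ^ 2 := by have := hf0 t ht; positivity
  have hr : r * ((2 * k + 1 : ℕ) : ℝ) = -((k + 1 : ℕ) : ℝ) := by
    simp only [r]
    push_cast
    field_simp
  calc (f t * (f t ^ 2) ^ r) ^ (2 * k + 1) * f t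
      = (f t ^ 2) ^ (k + 1) * ((f t ^ 2) ^ r) ^ (2 * k + 1) := by ring
    _ = (f t ^ 2) ^ (k + 1) * ((f t ^ 2) ^ (k + 1))⁻¹ := by
      rw [← Real.rpow_mul_natCast hpos.le, hr, Real.rpow_neg hpos.le, Real.rpow_natCast]
    _ = 1 := mul_inv_cancel₀ (pow_pos hpos _).ne'

end Wronskian

section Lifts

variable {γ : ℝ → ℙ ℝ (Fin 7 → ℝ)} {I J K : Set ℝ} {v w : ℝ → Fin 7 → ℝ} {t : ℝ}

namespace IsSmoothLift

theorem smul (hv : IsSmoothLift γ J v) {μ : ℝ → ℝ} (hμ : ContDiffOn ℝ ∞ μ J)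
    (hμ0 : ∀ s ∈ J, μ s ≠ 0) : IsSmoothLift γ J (μ • v) := by
  refine ⟨hμ.smul hv.1, fun s hs => ?_⟩
  obtain ⟨h0, h1⟩ := hv.2 s hs
  refine ⟨smul_ne_zero (hμ0 s hs) h0, ?_⟩
  rw [← h1, Projectivization.mk_eq_mk_iff']
  exact ⟨μ s, rfl⟩

theorem exists_eqOn_smul (hv : IsSmoothLift γ J v) (hw : IsSmoothLift γ K w) :
    ∃ μ : ℝ → ℝ, ContDiffOn ℝ ∞ μ (J ∩ K) ∧ Set.EqOn w (μ • v) (J ∩ K) := by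
  have hvJ := hv.1.mono (Set.inter_subset_left (t := K))
  have hwK := hw.1.mono (Set.inter_subset_right (s := J))
  have hdot {f g : ℝ → Fin 7 → ℝ} (hf : ContDiffOn ℝ ∞ f (J ∩ K))
      (hg : ContDiffOn ℝ ∞ g (J ∩ K)) : ContDiffOn ℝ ∞ (fun s => f s ⬝ᵥ g s) (J ∩ K) :=
    ContDiffOn.sum fun i _ => (contDiffOn_pi.1 hf i).mul (contDiffOn_pi.1 hg i)
  have hne : ∀ s ∈ J, v s ⬝ᵥ v s ≠ 0 := fun s hs h =>
    (hv.2 s hs).1 (dotProduct_self_eq_zero.1 h)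
  refine ⟨fun s => (w s ⬝ᵥ v s) / (v s ⬝ᵥ v s),
    (hdot hwK hvJ).div (hdot hvJ hvJ) fun s hs => hne s hs.1, fun s hs => ?_⟩
  obtain ⟨hv0, hvγ⟩ := hv.2 s hs.1
  obtain ⟨hw0, hwγ⟩ := hw.2 s hs.2
  obtain ⟨r, hr⟩ := (Projectivization.mk_eq_mk_iff' ℝ _ _ hw0 hv0).1 (hwγ.trans hvγ.symm)
  rw [Pi.smul_apply', ← hr, smul_dotProduct, smul_eq_mul, mul_div_cancel_right₀ _ (hne s hs.1)]

theorem eq_of_det_wronskianMatrix_eq_one (hJ : IsOpen J) (hK : IsOpen K)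
    (hv : IsSmoothLift γ J v) (hw : IsSmoothLift γ K w) (htJ : t ∈ J) (htK : t ∈ K)
    (hv1 : (wronskianMatrix v t).det = 1) (hw1 : (wronskianMatrix w t).det = 1) : v t = w t := by
  obtain ⟨μ, hμ, hwμ⟩ := hv.exists_eqOn_smul hw
  have hJK := hJ.inter hK
  have hμ7 : μ t ^ 7 = 1 := by
    rw [wronskianMatrix_congr (Filter.eventually_of_mem (hJK.mem_nhds ⟨htJ, htK⟩) hwμ),
      det_wronskianMatrix_smul hJK hμ (hv.1.mono Set.inter_subset_left) ⟨htJ, htK⟩, hv1,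
      mul_one] at hw1
    exact hw1
  have hμ1 : μ t = 1 := (Odd.strictMono_pow (by decide : Odd 7)).injective (by simpa using hμ7)
  rw [hwμ ⟨htJ, htK⟩, Pi.smul_apply', hμ1, one_smul]

theorem osculatingSpace_eq_span (hJ : IsOpen J) (hv : IsSmoothLift γ J v) (ht : t ∈ J) (j : ℕ) :
    osculatingSpace γ j t = Submodule.span ℝ {w | ∃ i ≤ j, w = iteratedDeriv i v t} := by
  refine le_antisymm (Submodule.span_le.2 ?_) (Submodule.span_mono ?_)
  · rintro _ ⟨K, w, hK, htK, hw, k, hk, rfl⟩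
    obtain ⟨μ, hμ, hwμ⟩ := hv.exists_eqOn_smul hw
    have hJK := hJ.inter hK
    have hwμt : w =ᶠ[nhds t] μ • v := Filter.eventually_of_mem (hJK.mem_nhds ⟨ht, htK⟩) hwμ
    rw [hwμt.iteratedDeriv_eq k,
      iteratedDeriv_smul_eq_sum hJK hμ (hv.1.mono Set.inter_subset_left) k ⟨ht, htK⟩]
    refine Submodule.sum_mem _ fun i hi => Submodule.smul_mem _ _ (Submodule.subset_span ?_)
    exact ⟨i, (Finset.mem_range_succ_iff.1 hi).trans hk, rfl⟩
  · rintro _ ⟨i, hi, rfl⟩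
    exact ⟨J, v, hJ, ht, hv, i, hi, rfl⟩

end IsSmoothLift

theorem exists_isSmoothLift_det_wronskianMatrix_eq_one_nhds (hγ : IsNondegenerateCurve γ I)
    (ht : t ∈ I) : ∃ (J : Set ℝ) (v : ℝ → Fin 7 → ℝ), IsOpen J ∧ t ∈ J ∧ IsSmoothLift γ J v ∧
      ∀ s ∈ J, (wronskianMatrix v s).det = 1 := by
  obtain ⟨J, v, hJ, htJ, hv, hli⟩ := hγ t ht
  have hdet : ∀ s ∈ J, (wronskianMatrix v s).det ≠ 0 := fun s hs =>
    ((Matrix.isUnit_iff_isUnit_det _).1 (Matrix.linearIndependent_cols_iff_isUnit.1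
      (show LinearIndependent ℝ (wronskianMatrix v s).col from hli s hs))).ne_zero
  obtain ⟨μ, hμ, hμ1⟩ := exists_contDiffOn_pow_mul_eq_one (by decide : Odd 7)
    (contDiffOn_det (contDiffOn_wronskianMatrix hJ hv.1)) hdet
  have hμ0 : ∀ s ∈ J, μ s ≠ 0 := fun s hs h => by simpa [h] using hμ1 s hs
  refine ⟨J, μ • v, hJ, htJ, hv.smul hμ hμ0, fun s hs => ?_⟩
  rw [det_wronskianMatrix_smul hJ hμ hv.1 hs, hμ1 s hs]

theorem exists_isSmoothLift_det_wronskianMatrix_eq_one (hI : IsOpen I)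
    (hγ : IsNondegenerateCurve γ I) :
    ∃ v, IsSmoothLift γ I v ∧ ∀ t ∈ I, (wronskianMatrix v t).det = 1 := by
  classical
  choose J V hJ hmem hV hW using fun (t : ℝ) (ht : t ∈ I) =>
    exists_isSmoothLift_det_wronskianMatrix_eq_one_nhds hγ ht
  let v : ℝ → Fin 7 → ℝ := fun t => if ht : t ∈ I then V t ht t else 0
  have hv (t : ℝ) (ht : t ∈ I) : v =ᶠ[nhds t] V t ht := by
    filter_upwards [(hJ t ht).mem_nhds (hmem t ht), hI.mem_nhds ht] with s hsJ hsI
    simp only [v, dif_pos hsI]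
    exact (hV s hsI).eq_of_det_wronskianMatrix_eq_one (hJ s hsI) (hJ t ht) (hV t ht)
      (hmem s hsI) hsJ (hW s hsI s (hmem s hsI)) (hW t ht s hsJ)
  refine ⟨v, ⟨fun t ht => ?_, fun t ht => ?_⟩, fun t ht => ?_⟩
  · exact (((hV t ht).1.contDiffAt ((hJ t ht).mem_nhds (hmem t ht))).congr_of_eventuallyEq
      (hv t ht)).contDiffWithinAt
  · rw [(hv t ht).eq_of_nhds]
    exact (hV t ht).2 t (hmem t ht)
  · rw [wronskianMatrix_congr (hv t ht)]
    exact hW t ht t (hmem t ht)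

theorem form_lift_iteratedDeriv_two_eq_zero (hI : IsOpen I) (hv : ContDiffOn ℝ ∞ v I)
    {Ω : (Fin 7 → ℝ) [⋀^Fin 3]→ₗ[ℝ] ℝ} {w : Fin 7 → ℝ}
    (h : ∀ t ∈ I, Ω ![v t, iteratedDeriv 1 v t, w] = 0) (ht : t ∈ I) :
    Ω ![v t, iteratedDeriv 2 v t, w] = 0 := by
  have hg : ∀ i, HasDerivAt (fun s => (![v s, iteratedDeriv 1 v s, w] : Fin 3 → Fin 7 → ℝ) i)
      ((![iteratedDeriv 1 v t, iteratedDeriv 2 v t, 0] : Fin 3 → Fin 7 → ℝ) i) t := by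
    have h0 : HasDerivAt v (iteratedDeriv 1 v t) t := hasDerivAt_iteratedDeriv hv hI 0 ht
    intro i
    fin_cases i
    exacts [h0, hasDerivAt_iteratedDeriv hv hI 1 ht, hasDerivAt_const t w]
  have hderiv := (hasDerivAt_alternatingMap Ω hg).unique
    ((hasDerivAt_const t (0 : ℝ)).congr_of_eventuallyEq
      (Filter.eventually_of_mem (hI.mem_nhds ht) h))
  rw [Fin.sum_univ_three] at hderiv
  have h0 : Ω (Function.update ![v t, iteratedDeriv 1 v t, w] 0 (iteratedDeriv 1 v t)) = 0 :=
    Ω.map_eq_zero_of_eq _ (i := 0) (j := 1) (by simp) (by decide)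
  have h1 : Function.update ![v t, iteratedDeriv 1 v t, w] 1 (iteratedDeriv 2 v t) =
      ![v t, iteratedDeriv 2 v t, w] := by
    ext1 i
    fin_cases i <;> rfl
  simpa [-iteratedDeriv_one, h0, h1] using hderiv

theorem IsSmoothLift.isCompatible_iff (hI : IsOpen I) (hv : IsSmoothLift γ I v)
    (Ω : (Fin 7 → ℝ) [⋀^Fin 3]→ₗ[ℝ] ℝ) :
    IsCompatible γ I Ω ↔ ∀ t ∈ I, ∀ w, Ω ![v t, deriv v t, w] = 0 := by
  have hspan (t : ℝ) (ht : t ∈ I) := hv.osculatingSpace_eq_span hI ht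
  refine ⟨fun h t ht => h t ht _ ?_ _ ?_, fun h t ht a ha b hb w => ?_⟩
  · rw [hspan t ht]
    exact Submodule.subset_span ⟨0, le_rfl, by simp⟩
  · rw [hspan t ht]
    exact Submodule.subset_span ⟨1, by simp, by simp⟩
  simp only [← iteratedDeriv_one] at h
  rw [hspan t ht] at ha hb
  obtain ⟨c, rfl⟩ : ∃ c : ℝ, c • v t = a := by
    simpa only [Nat.le_zero, exists_eq_left, iteratedDeriv_zero, Set.ofPred_eq_eq_singleton,
      Submodule.mem_span_singleton] using ha
  have hb0 : b ∈ LinearMap.ker (Ω.curryLeft (v t)).curryLeft := by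
    refine Submodule.span_le.2 ?_ hb
    rintro _ ⟨i, hi, rfl⟩
    refine AlternatingMap.ext fun u => ?_
    obtain ⟨u, rfl⟩ : ∃ x, u = ![x] := ⟨u 0, by ext i; fin_cases i; rfl⟩
    change Ω ![v t, iteratedDeriv i v t, u] = 0
    interval_cases i
    · exact Ω.map_eq_zero_of_eq _ (i := 0) (j := 1) (by simp) (by decide)
    · exact h t ht u
    · exact form_lift_iteratedDeriv_two_eq_zero hI hv.1 (fun s hs => h s hs u) ht
  have hw : Ω ![v t, b, w] = 0 := DFunLike.congr_fun (LinearMap.mem_ker.1 hb0) ![w]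
  calc Ω ![c • v t, b, w] = c * Ω ![v t, b, w] :=
        DFunLike.congr_fun (Ω.curryLeft.map_smul c (v t)) ![b, w]
    _ = 0 := by rw [hw, mul_zero]

end Lifts

/-! ## The principal `sl₂` in `sl₇` -/

section DiagonalFiltration

variable {n : ℕ} {R : Type*} [CommRing R]

/-- The matrices supported on and above the `d`-th superdiagonal. They filter the matrix algebra,
with `sl2X` in degree `-1` and `sl2Y` in degree `1`. -/
def diagonalFiltration (n : ℕ) (d : ℤ) : Submodule R (Matrix (Fin n) (Fin n) R) where
  carrier := {M | ∀ i j : Fin n, (j : ℤ) - i < d → M i j = 0}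
  zero_mem' _ _ _ := rfl
  add_mem' hM hN i j h := by rw [Matrix.add_apply, hM i j h, hN i j h, add_zero]
  smul_mem' c M hM i j h := by rw [Matrix.smul_apply, hM i j h, smul_zero]

theorem diagonalFiltration_antitone : Antitone (diagonalFiltration (R := R) n) :=
  fun _ _ hde _ hM i j h => hM i j (h.trans_le hde)

theorem mul_mem_diagonalFiltration {d e : ℤ} {M N : Matrix (Fin n) (Fin n) R}
    (hM : M ∈ diagonalFiltration n d) (hN : N ∈ diagonalFiltration n e) :
    M * N ∈ diagonalFiltration n (d + e) := by
  intro i j h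
  rw [Matrix.mul_apply]
  refine Finset.sum_eq_zero fun l _ => ?_
  obtain hl | hl := lt_or_ge ((l : ℤ) - i) d
  · rw [hM i l hl, zero_mul]
  · rw [hN l j (by omega), mul_zero]

theorem one_mem_diagonalFiltration : (1 : Matrix (Fin n) (Fin n) R) ∈ diagonalFiltration n 0 :=
  fun i j h => Matrix.one_apply_ne fun hij => by subst hij; omega

theorem pow_mem_diagonalFiltration {M : Matrix (Fin n) (Fin n) R}
    (hM : M ∈ diagonalFiltration n 1) (m : ℕ) : M ^ m ∈ diagonalFiltration n m := by
  induction m with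
  | zero => simpa using one_mem_diagonalFiltration
  | succ m ih => simpa only [pow_succ, Nat.cast_succ] using mul_mem_diagonalFiltration ih hM

theorem diagonalFiltration_self : diagonalFiltration (R := R) n n = ⊥ := by
  refine (Submodule.eq_bot_iff _).2 fun M hM => ?_
  ext i j
  exact hM i j (by omega)

theorem trace_eq_zero_of_mem_diagonalFiltration {M : Matrix (Fin n) (Fin n) R}
    (hM : M ∈ diagonalFiltration n 1) : M.trace = 0 :=
  Finset.sum_eq_zero fun i _ => hM i i (by omega)

theorem det_one_add_of_mem_diagonalFiltration {N : Matrix (Fin n) (Fin n) R}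
    (hN : N ∈ diagonalFiltration n 1) : (1 + N).det = 1 := by
  have hT : (1 + N).IsUpperTriangular := by
    intro i j (hij : j < i)
    rw [Matrix.add_apply, Matrix.one_apply_ne hij.ne', hN i j (by omega), add_zero]
  rw [Matrix.det_of_isUpperTriangular hT]
  exact Finset.prod_eq_one fun i _ => by
    rw [Matrix.add_apply, Matrix.one_apply_eq, hN i i (by omega), add_zero]

theorem inv_mem_diagonalFiltration {M : Matrix (Fin n) (Fin n) R}
    (hM : M ∈ diagonalFiltration n 0) (hu : IsUnit M) : M⁻¹ ∈ diagonalFiltration n 0 := by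
  have := hu.invertible
  have hT : M.BlockTriangular id := fun i j (hij : j < i) => hM i j (by omega)
  exact fun i j h => Matrix.blockTriangular_inv_of_blockTriangular hT (show j < i by omega)

end DiagonalFiltration

section PrincipalSL2

theorem sl2X_mem_diagonalFiltration : sl2X ∈ diagonalFiltration 7 (-1) :=
  fun _ _ h => if_neg (by omega)

theorem sl2Y_mem_diagonalFiltration : sl2Y ∈ diagonalFiltration 7 1 :=
  fun _ _ h => if_neg (by omega)

theorem sl2X_mul_apply (N : Matrix (Fin 7) (Fin 7) ℝ) (i j : Fin 7) :
    (sl2X * N) i j = if h : 0 < (i : ℕ) then N ⟨i - 1, by omega⟩ j else 0 := by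
  simp only [Matrix.mul_apply, sl2X, Matrix.of_apply, ite_mul, one_mul, zero_mul]
  split_ifs with h
  · rw [Finset.sum_eq_single (⟨i - 1, by omega⟩ : Fin 7)]
    · rw [if_pos (by simp only; omega)]
    · intro l _ hl
      rw [if_neg]
      exact fun h' => hl (Fin.ext (by simp only; omega))
    · simp
  · exact Finset.sum_eq_zero fun l _ => if_neg (by omega)

theorem mul_sl2X_apply (N : Matrix (Fin 7) (Fin 7) ℝ) (i j : Fin 7) :
    (N * sl2X) i j = if h : (j : ℕ) + 1 < 7 then N i ⟨j + 1, h⟩ else 0 := by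
  simp only [Matrix.mul_apply, sl2X, Matrix.of_apply, mul_ite, mul_one, mul_zero]
  split_ifs with h
  · rw [Finset.sum_eq_single (⟨j + 1, h⟩ : Fin 7)]
    · rw [if_pos rfl]
    · intro l _ hl
      rw [if_neg]
      exact fun h' => hl (Fin.ext h')
    · simp
  · exact Finset.sum_eq_zero fun l _ => if_neg (by omega)

theorem mul_sl2X_pow_apply (N : Matrix (Fin 7) (Fin 7) ℝ) (k : ℕ) (i j : Fin 7) :
    (N * sl2X ^ k) i j = if h : (j : ℕ) + k < 7 then N i ⟨j + k, h⟩ else 0 := by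
  induction k generalizing j with
  | zero => simp
  | succ k ih =>
    rw [pow_succ, ← mul_assoc, mul_sl2X_apply]
    simp only [ih, add_assoc, add_comm 1 k]
    split_ifs <;> first | rfl | omega

theorem sl2Y_pow_apply_pos {k : ℕ} {i j : Fin 7} (h : (j : ℕ) = i + k) : 0 < (sl2Y ^ k) i j := by
  induction k generalizing j with
  | zero => simp [show j = i from Fin.ext h]
  | succ k ih =>
    let l : Fin 7 := ⟨i + k, by omega⟩
    have hl : ∀ m, m ≠ l → (sl2Y ^ k) i m * sl2Y m j = 0 := fun m hm => by
      have : sl2Y m j = 0 := if_neg fun hmj => hm (Fin.ext (by simp only [l]; omega))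
      rw [this, mul_zero]
    rw [pow_succ, Matrix.mul_apply, Finset.sum_eq_single l (fun m _ => hl m) (by simp)]
    have hY : sl2Y l j = ((l : ℝ) + 1) * (6 - l) := if_pos (by simp only [l]; omega)
    have hl6 : (l : ℝ) < 6 := by exact_mod_cast (by simp only [l]; omega : (l : ℕ) < 6)
    rw [hY]
    exact mul_pos (ih rfl) (mul_pos (by positivity) (by linarith))

theorem trace_sl2Y_pow_mul_sl2X_pow_pos {k : ℕ} (hk : k < 7) :
    0 < (sl2Y ^ k * sl2X ^ k).trace := by
  have hentry (i : Fin 7) : (sl2Y ^ k * sl2X ^ k) i i =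
      if h : (i : ℕ) + k < 7 then (sl2Y ^ k) i ⟨i + k, h⟩ else 0 := mul_sl2X_pow_apply _ _ _ _
  refine Finset.sum_pos' (fun i _ => ?_) ⟨0, Finset.mem_univ _, ?_⟩
  · rw [Matrix.diag_apply, hentry]
    split_ifs
    exacts [(sl2Y_pow_apply_pos rfl).le, le_rfl]
  · rw [Matrix.diag_apply, hentry, dif_pos (by simpa using hk)]
    exact sl2Y_pow_apply_pos rfl

-- The commutator with `sl2X` is a difference operator along each superdiagonal, so `N` is found by
-- summing up the entries of `R`; the trace condition makes the total sum vanish.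
theorem exists_add_commutator_sl2X_mem {k : ℕ} {R : Matrix (Fin 7) (Fin 7) ℝ}
    (hR : R ∈ diagonalFiltration 7 k) (hR0 : (R * sl2X ^ k).trace = 0) :
    ∃ N ∈ diagonalFiltration 7 (k + 1),
      R + (sl2X * N - N * sl2X) ∈ diagonalFiltration 7 (k + 1) := by
  let d : ℕ → ℝ := fun l => if h : l < 7 then (R * sl2X ^ k) ⟨l, h⟩ ⟨l, h⟩ else 0
  have hd0 : ∀ l, 7 ≤ l + k → d l = 0 := fun l hl => by
    simp only [d, mul_sl2X_pow_apply, dif_neg hl.not_gt, dite_eq_ite, ite_self]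
  have hdsum : ∑ l ∈ Finset.range 7, d l = 0 := by
    rw [Finset.sum_range, ← hR0]
    simp [d, Matrix.trace]
  let N : Matrix (Fin 7) (Fin 7) ℝ :=
    Matrix.of fun i j => if (j : ℕ) = i + k + 1 then ∑ l ∈ Finset.range (i + 1), d l else 0
  have hN : N ∈ diagonalFiltration 7 (k + 1) := fun i j h => if_neg (by omega)
  refine ⟨N, hN, fun i j hij => ?_⟩
  obtain hlt | heq : (j : ℤ) - i < k ∨ (j : ℕ) = i + k := by omega
  · have hmem : R + (sl2X * N - N * sl2X) ∈ diagonalFiltration 7 k := by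
      refine add_mem hR (sub_mem ?_ ?_)
      · simpa using mul_mem_diagonalFiltration sl2X_mem_diagonalFiltration hN
      · simpa using mul_mem_diagonalFiltration hN sl2X_mem_diagonalFiltration
    exact hmem i j hlt
  have hxN : (sl2X * N) i j = ∑ l ∈ Finset.range i, d l := by
    rw [sl2X_mul_apply]
    split_ifs with h
    · simp only [N, Matrix.of_apply]
      rw [if_pos (by omega), Nat.sub_add_cancel h]
    · rw [show (i : ℕ) = 0 by omega, Finset.sum_range_zero]
  have hNx : (N * sl2X) i j = ∑ l ∈ Finset.range (i + 1), d l := by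
    rw [mul_sl2X_apply]
    split_ifs with h
    · exact if_pos (by simp only; omega)
    · rw [← hdsum]
      refine (Finset.sum_subset (Finset.range_subset_range.2 i.isLt) fun l _ hl => hd0 l ?_).symm
      have := mt Finset.mem_range.2 hl
      omega
  have hdi : d i = R i j := by
    simp only [d, mul_sl2X_pow_apply, dif_pos i.isLt, ← heq, dif_pos j.isLt]
  rw [Matrix.add_apply, Matrix.sub_apply, hxN, hNx, Finset.sum_range_succ, hdi]
  ring

end PrincipalSL2

/-! ## Existence of canonical frames -/

theorem exists_linearMap_add_mem {K E P : Type*} [Field K] [AddCommGroup E] [Module K E]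
    [AddCommGroup P] [Module K P] (L : P →ₗ[K] E) {V W : Submodule K E}
    (h : ∀ R ∈ V, ∃ p, R + L p ∈ W) : ∃ σ : E →ₗ[K] P, ∀ R ∈ V, R + L (σ R) ∈ W := by
  let f := W.mkQ ∘ₗ L
  obtain ⟨g, hg⟩ := f.rangeRestrict.exists_rightInverse_of_surjective f.range_rangeRestrict
  obtain ⟨g', hg'⟩ := g.exists_extend
  refine ⟨-(g' ∘ₗ W.mkQ), fun R hR => ?_⟩
  obtain ⟨p, hp⟩ := h R hR
  have hfp : f (-p) = W.mkQ R := by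
    rw [map_neg, neg_eq_iff_add_eq_zero, add_comm, LinearMap.comp_apply, ← map_add]
    exact (Submodule.Quotient.mk_eq_zero W).2 hp
  have hfg : f (g' (f (-p))) = f (-p) := by
    have h1 : g' (f (-p)) = g (f.rangeRestrict (-p)) :=
      LinearMap.congr_fun hg' (f.rangeRestrict (-p))
    rw [h1]
    exact congrArg Subtype.val (LinearMap.congr_fun hg (f.rangeRestrict (-p)))
  refine (Submodule.Quotient.mk_eq_zero W).1 ?_
  change W.mkQ (R + L _) = 0
  rw [map_add, LinearMap.neg_apply, map_neg, map_neg, LinearMap.comp_apply, ← hfp,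
    ← sub_eq_add_neg]
  exact sub_eq_zero.2 hfg.symm

theorem inv_mul_deriv_mul {n : Type*} [Fintype n] [DecidableEq n] {F G : ℝ → Matrix n n ℝ}
    {A G' : Matrix n n ℝ} {t : ℝ} (hF : HasDerivAt F (F t * A) t) (hG : HasDerivAt G G' t)
    (hu : IsUnit (F t).det) :
    (F t * G t)⁻¹ * deriv (fun s => F s * G s) t = (G t)⁻¹ * (A * G t + G') := by
  have h : deriv (fun s => F s * G s) t = F t * (A * G t + G') :=
    (hF.fun_mul hG).deriv.trans (by rw [mul_add, mul_assoc])
  rw [h, Matrix.mul_inv_rev, mul_assoc, ← mul_assoc (F t)⁻¹, Matrix.nonsing_inv_mul _ hu, one_mul]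

section NormalForm

/-- The matrices whose entries below the `k`-th superdiagonal are those of a polynomial in
`sl2Y`. -/
def normalSpace (k : ℕ) : Submodule ℝ (Matrix (Fin 7) (Fin 7) ℝ) :=
  Submodule.span ℝ (Set.range fun m : Fin k => sl2Y ^ (m : ℕ)) ⊔ diagonalFiltration 7 k

theorem diagonalFiltration_le_normalSpace (k : ℕ) : diagonalFiltration 7 k ≤ normalSpace k :=
  le_sup_right

theorem normalSpace_le_diagonalFiltration (k : ℕ) : normalSpace k ≤ diagonalFiltration 7 0 := by
  refine sup_le (Submodule.span_le.2 ?_) (diagonalFiltration_antitone (Int.natCast_nonneg k))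
  rintro _ ⟨m, rfl⟩
  exact diagonalFiltration_antitone (Int.natCast_nonneg _)
    (pow_mem_diagonalFiltration sl2Y_mem_diagonalFiltration m)

-- By `sl₂` representation theory `sl2Y ^ k` spans a complement of the image of `ad sl2X` on the
-- `k`-th superdiagonal; concretely, the trace form pairs it nontrivially with `sl2X ^ k`, which is
-- orthogonal to that image.
theorem exists_add_commutator_sl2X_mem_normalSpace {k : ℕ} (hk : k < 7)
    {R : Matrix (Fin 7) (Fin 7) ℝ} (hR : R ∈ normalSpace k) :
    ∃ N ∈ diagonalFiltration 7 (k + 1), R + (sl2X * N - N * sl2X) ∈ normalSpace (k + 1) := by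
  obtain ⟨P, hP, S, hS, rfl⟩ := Submodule.mem_sup.1 hR
  let c := (S * sl2X ^ k).trace / (sl2Y ^ k * sl2X ^ k).trace
  have htrace : ((S - c • sl2Y ^ k) * sl2X ^ k).trace = 0 := by
    rw [sub_mul, Matrix.smul_mul, Matrix.trace_sub, Matrix.trace_smul, smul_eq_mul,
      div_mul_cancel₀ _ (trace_sl2Y_pow_mul_sl2X_pow_pos hk).ne', sub_self]
  have hmem : S - c • sl2Y ^ k ∈ diagonalFiltration 7 k :=
    sub_mem hS (Submodule.smul_mem _ c (pow_mem_diagonalFiltration sl2Y_mem_diagonalFiltration k))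
  obtain ⟨N, hN, hSN⟩ := exists_add_commutator_sl2X_mem hmem htrace
  refine ⟨N, hN, Submodule.mem_sup.2 ⟨P + c • sl2Y ^ k, add_mem ?_ ?_, _, hSN, by abel⟩⟩
  · refine Submodule.span_mono ?_ hP
    rintro _ ⟨m, rfl⟩
    exact ⟨m.castSucc, rfl⟩
  · exact Submodule.smul_mem _ c (Submodule.subset_span ⟨Fin.last k, rfl⟩)

theorem exists_linearMap_add_commutator_sl2X_mem {k : ℕ} (hk : k < 7) :
    ∃ σ : Matrix (Fin 7) (Fin 7) ℝ →ₗ[ℝ] diagonalFiltration (R := ℝ) 7 (k + 1), ∀ R ∈ normalSpace k,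
      R + (sl2X * (σ R : Matrix (Fin 7) (Fin 7) ℝ) - σ R * sl2X) ∈ normalSpace (k + 1) := by
  refine exists_linearMap_add_mem
    ((LinearMap.mulLeft ℝ sl2X - LinearMap.mulRight ℝ sl2X) ∘ₗ Submodule.subtype _)
    fun R hR => ?_
  obtain ⟨N, hN, hRN⟩ := exists_add_commutator_sl2X_mem_normalSpace hk hR
  exact ⟨⟨N, hN⟩, hRN⟩

theorem gauge_sub_commutator_sl2X_mem {k : ℕ} {A N N' : Matrix (Fin 7) (Fin 7) ℝ}
    (hA : A - sl2X ∈ diagonalFiltration 7 0) (hN : N ∈ diagonalFiltration 7 (k + 1))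
    (hN' : N' ∈ diagonalFiltration 7 (k + 1)) :
    (1 + N)⁻¹ * (A * (1 + N) + N') - (A + (sl2X * N - N * sl2X)) ∈
      diagonalFiltration 7 (k + 1) := by
  have hN1 : N ∈ diagonalFiltration 7 1 := diagonalFiltration_antitone (by omega) hN
  have hu : IsUnit (1 + N) := (Matrix.isUnit_iff_isUnit_det _).2 <| by
    rw [det_one_add_of_mem_diagonalFiltration hN1]
    exact isUnit_one
  have hfactor : (1 + N)⁻¹ * (A * (1 + N) + N') - (A + (sl2X * N - N * sl2X)) =
      (1 + N)⁻¹ * ((A - sl2X) * N - N * (A - sl2X) + N' - N * (sl2X * N - N * sl2X)) := by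
    have hinv := Matrix.nonsing_inv_mul _ ((Matrix.isUnit_iff_isUnit_det _).1 hu)
    calc (1 + N)⁻¹ * (A * (1 + N) + N') - (A + (sl2X * N - N * sl2X))
        = (1 + N)⁻¹ * (A * (1 + N) + N') - (1 + N)⁻¹ * (1 + N) * (A + (sl2X * N - N * sl2X)) := by
          rw [hinv, one_mul]
      _ = _ := by rw [mul_assoc, ← mul_sub]; congr 1; noncomm_ring
  have hcomm : sl2X * N - N * sl2X ∈ diagonalFiltration 7 k := by
    refine sub_mem ?_ ?_
    · simpa using mul_mem_diagonalFiltration sl2X_mem_diagonalFiltration hN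
    · simpa using mul_mem_diagonalFiltration hN sl2X_mem_diagonalFiltration
  have hinv : (1 + N)⁻¹ ∈ diagonalFiltration 7 0 := inv_mem_diagonalFiltration
    (add_mem one_mem_diagonalFiltration (diagonalFiltration_antitone zero_le_one hN1)) hu
  rw [hfactor, ← zero_add ((k : ℤ) + 1)]
  refine mul_mem_diagonalFiltration hinv (sub_mem (add_mem (sub_mem ?_ ?_) hN') ?_)
  · simpa using mul_mem_diagonalFiltration hA hN
  · simpa using mul_mem_diagonalFiltration hN hA
  · exact add_comm 1 (k : ℤ) ▸ mul_mem_diagonalFiltration hN1 hcomm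

end NormalForm

section CanonicalFrame

variable {γ : ℝ → ℙ ℝ (Fin 7 → ℝ)} {I : Set ℝ} {v : ℝ → Fin 7 → ℝ} {k : ℕ}
  {F : ℝ → Matrix (Fin 7) (Fin 7) ℝ}

/-- A moving frame over `v` in `SL(7, ℝ)` whose Maurer-Cartan matrix `F⁻¹ F'` has the form
required of a canonical frame below the `k`-th superdiagonal. These are the stages in the
construction of a canonical frame. -/
structure IsNormalizedFrame (I : Set ℝ) (v : ℝ → Fin 7 → ℝ) (k : ℕ)
    (F : ℝ → Matrix (Fin 7) (Fin 7) ℝ) : Prop where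
  contDiffOn : ContDiffOn ℝ ∞ F I
  det_eq_one : ∀ t ∈ I, (F t).det = 1
  col_zero : ∀ t ∈ I, (F t).col 0 = v t
  inv_mul_deriv_sub_mem : ∀ t ∈ I, (F t)⁻¹ * deriv F t - sl2X ∈ normalSpace k

theorem isNormalizedFrame_wronskianMatrix (hI : IsOpen I) (hv : ContDiffOn ℝ ∞ v I)
    (hW : ∀ t ∈ I, (wronskianMatrix v t).det = 1) :
    IsNormalizedFrame I v 0 (wronskianMatrix v) where
  contDiffOn := contDiffOn_wronskianMatrix hI hv
  det_eq_one := hW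
  col_zero t _ := by
    ext i
    simp [wronskianMatrix]
  inv_mul_deriv_sub_mem t ht := by
    have hderiv : deriv (wronskianMatrix v) t =
        Matrix.of fun i j : Fin 7 => iteratedDeriv (j + 1) v t i :=
      (hasDerivAt_matrix.2 fun i (j : Fin 7) =>
        hasDerivAt_pi.1 (hasDerivAt_iteratedDeriv hv hI j ht) i).deriv
    have hu : IsUnit (wronskianMatrix v t).det := by rw [hW t ht]; exact isUnit_one
    have hfactor : (wronskianMatrix v t)⁻¹ * deriv (wronskianMatrix v) t - sl2X =
        (wronskianMatrix v t)⁻¹ * (deriv (wronskianMatrix v) t - wronskianMatrix v t * sl2X) := by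
      rw [mul_sub, ← mul_assoc, Matrix.nonsing_inv_mul _ hu, one_mul]
    refine diagonalFiltration_le_normalSpace 0 fun i j hij => ?_
    rw [hfactor, hderiv, Matrix.mul_apply]
    refine Finset.sum_eq_zero fun l _ => mul_eq_zero_of_right _ ?_
    rw [Matrix.sub_apply, mul_sl2X_apply, dif_pos (by omega)]
    exact sub_self _

namespace IsNormalizedFrame

theorem isUnit_det (hF : IsNormalizedFrame I v k F) {t : ℝ} (ht : t ∈ I) : IsUnit (F t).det := by
  rw [hF.det_eq_one t ht]
  exact isUnit_one

theorem hasDerivAt (hF : IsNormalizedFrame I v k F) (hI : IsOpen I) {t : ℝ} (ht : t ∈ I) :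
    HasDerivAt F (F t * ((F t)⁻¹ * deriv F t)) t := by
  rw [← mul_assoc, Matrix.mul_nonsing_inv _ (hF.isUnit_det ht), one_mul]
  exact ((hF.contDiffOn.contDiffAt (hI.mem_nhds ht)).differentiableAt (by simp)).hasDerivAt

theorem exists_succ (hI : IsOpen I) (hk : k < 7) (hF : IsNormalizedFrame I v k F) :
    ∃ G, IsNormalizedFrame I v (k + 1) G := by
  obtain ⟨σ, hσ⟩ := exists_linearMap_add_commutator_sl2X_mem hk
  let A : ℝ → Matrix (Fin 7) (Fin 7) ℝ := fun t => (F t)⁻¹ * deriv F t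
  have hA : ContDiffOn ℝ ∞ A I := (contDiffOn_nonsing_inv hF.contDiffOn fun t ht =>
    (Matrix.isUnit_iff_isUnit_det _).2 (hF.isUnit_det ht)).mul
      (hF.contDiffOn.deriv_of_isOpen hI le_rfl)
  let L := (Submodule.subtype _ ∘ₗ σ).toContinuousLinearMap
  let N : ℝ → Matrix (Fin 7) (Fin 7) ℝ := fun t => L (A t - sl2X)
  have hN : ContDiffOn ℝ ∞ N I := L.contDiff.comp_contDiffOn (hA.sub contDiffOn_const)
  have hL (R) : L R ∈ diagonalFiltration 7 (k + 1) := (σ R).2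
  have hN1 (t) : N t ∈ diagonalFiltration 7 1 := diagonalFiltration_antitone (by omega) (hL _)
  refine ⟨fun t => F t * (1 + N t), hF.contDiffOn.mul (contDiffOn_const.add hN), fun t ht => ?_,
    fun t ht => ?_, fun t ht => ?_⟩
  · rw [Matrix.det_mul, hF.det_eq_one t ht, det_one_add_of_mem_diagonalFiltration (hN1 t), one_mul]
  · have hcol : (1 + N t).col 0 = Pi.single 0 1 := by
      ext i
      simp [hN1 t i 0 (by change (0 : ℤ) - i < 1; omega), Matrix.one_apply, Pi.single_apply]
    rw [← Matrix.mulVec_single_one, ← Matrix.mulVec_mulVec, Matrix.mulVec_single_one, hcol,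
      Matrix.mulVec_single_one, hF.col_zero t ht]
  · have hA' := ((hA.contDiffAt (hI.mem_nhds ht)).differentiableAt (by simp)).hasDerivAt
    have hN' : HasDerivAt (fun s => 1 + N s) (L (deriv A t)) t :=
      (L.hasFDerivAt.comp_hasDerivAt t (hA'.sub_const sl2X)).const_add 1
    have hmem := hF.inv_mul_deriv_sub_mem t ht
    have hgauge := gauge_sub_commutator_sl2X_mem (normalSpace_le_diagonalFiltration k hmem)
      (hL (A t - sl2X)) (hL (deriv A t))
    rw [inv_mul_deriv_mul (hF.hasDerivAt hI ht) hN' (hF.isUnit_det ht)]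
    convert add_mem (diagonalFiltration_le_normalSpace (k + 1) hgauge) (hσ _ hmem) using 1
    change _ = (_ - (A t + (sl2X * N t - N t * sl2X))) + (A t - sl2X + (sl2X * N t - N t * sl2X))
    abel

theorem exists_eq_sl2X_add_sum (hI : IsOpen I) (hF : IsNormalizedFrame I v 7 F) {t : ℝ}
    (ht : t ∈ I) : ∃ c : Fin 6 → ℝ,
      HasDerivAt F (F t * (sl2X + ∑ m, c m • sl2Y ^ (m + 1 : ℕ))) t := by
  have hmem := hF.inv_mul_deriv_sub_mem t ht
  have hbot : diagonalFiltration (R := ℝ) 7 (7 : ℕ) = ⊥ := diagonalFiltration_self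
  rw [normalSpace, hbot, sup_bot_eq, Submodule.mem_span_range_iff_exists_fun] at hmem
  obtain ⟨a, ha⟩ := hmem
  let p := ∑ m : Fin 6, a m.succ • sl2Y ^ (m + 1 : ℕ)
  have hp : p.trace = 0 := trace_eq_zero_of_mem_diagonalFiltration <| sum_mem fun m _ =>
    Submodule.smul_mem _ _ <| diagonalFiltration_antitone (by omega) <|
      pow_mem_diagonalFiltration sl2Y_mem_diagonalFiltration _
  have hA : (F t)⁻¹ * deriv F t = sl2X + (a 0 • 1 + p) := by
    rw [← sub_eq_iff_eq_add', ← ha, Fin.sum_univ_succ]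
    simp [p]
  have hderiv := hF.hasDerivAt hI ht
  rw [hA] at hderiv
  have htrace : (sl2X + (a 0 • 1 + p)).trace = 0 := by
    have h0 := (hasDerivAt_det hderiv).unique ((hasDerivAt_const t (1 : ℝ)).congr_of_eventuallyEq
      (Filter.eventually_of_mem (hI.mem_nhds ht) hF.det_eq_one))
    rwa [hF.det_eq_one t ht, one_mul] at h0
  have ha0 : a 0 = 0 := by
    have hX : sl2X.trace = 0 := Finset.sum_eq_zero fun i _ => if_neg (by omega)
    simpa [Matrix.trace_add, hX, hp] using htrace
  exact ⟨fun m => a m.succ, by simpa [ha0] using hderiv⟩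

end IsNormalizedFrame

theorem exists_isCanonicalFrame (hI : IsOpen I) (hγ : IsNondegenerateCurve γ I) :
    ∃ F θ, IsCanonicalFrame γ I F θ := by
  obtain ⟨v, hv, hW⟩ := exists_isSmoothLift_det_wronskianMatrix_eq_one hI hγ
  have hnorm : ∀ k ≤ 7, ∃ F, IsNormalizedFrame I v k F := fun k => by
    induction k with
    | zero => exact fun _ => ⟨_, isNormalizedFrame_wronskianMatrix hI hv.1 hW⟩
    | succ k ih =>
      intro hk
      obtain ⟨F, hF⟩ := ih (by omega)
      exact hF.exists_succ hI hk
  obtain ⟨F, hF⟩ := hnorm 7 le_rfl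
  choose! c hc using fun t (ht : t ∈ I) => hF.exists_eq_sl2X_add_sum hI ht
  refine ⟨F, fun m t => c t (Fin.ofNat 6 (m - 2)), contDiffOn_matrix.1 hF.contDiffOn, hF.det_eq_one,
    fun t ht => ?_, fun t ht => ⟨0, c t 0, hasDerivAt_matrix.1 ?_⟩⟩
  · have hcol : (fun i => F t i 0) = v t := hF.col_zero t ht
    simp only [hcol]
    exact hv.2 t ht
  · convert hc t ht using 2
    have hone : Fin.ofNat 6 1 = 1 := rfl
    simp [Fin.sum_univ_succ, Finset.sum_Icc_succ_top, add_assoc, hone,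
      -Fin.ofNat_eq_cast]

end CanonicalFrame

/-! ## The invariant three-form -/

section InvariantForm

/-- The identification of `ℝ⁷` with the imaginary split octonions for which the split `G₂`
contains the irreducible `SL₂` with Lie algebra `⟨x, h, y⟩`. -/
noncomputable def imSplitOctEquiv : (Fin 7 → ℝ) ≃ₗ[ℝ] ImSplitOct where
  toFun p := ⟨(p 3, ![p 0, 2 * p 5, 2 * p 4], ![-2 * p 6, p 1, -p 2], -p 3), by
    simp [SplitOct.re]⟩
  map_add' p q := by
    refine Subtype.ext (Prod.ext rfl (Prod.ext ?_ (Prod.ext ?_ (neg_add _ _))))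
    · change ![p 0 + q 0, 2 * (p 5 + q 5), 2 * (p 4 + q 4)] =
        ![p 0, 2 * p 5, 2 * p 4] + ![q 0, 2 * q 5, 2 * q 4]
      simp [mul_add]
    · change ![-2 * (p 6 + q 6), p 1 + q 1, -(p 2 + q 2)] =
        ![-2 * p 6, p 1, -p 2] + ![-2 * q 6, q 1, -q 2]
      simp [mul_add, add_comm]
  map_smul' r p := by
    refine Subtype.ext (Prod.ext rfl (Prod.ext ?_ (Prod.ext ?_ (mul_neg _ _).symm)))
    · change ![r * p 0, 2 * (r * p 5), 2 * (r * p 4)] = r • ![p 0, 2 * p 5, 2 * p 4]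
      simp [mul_left_comm]
    · change ![-2 * (r * p 6), r * p 1, -(r * p 2)] = r • ![-2 * p 6, p 1, -p 2]
      simp [mul_left_comm]
  invFun q := ![q.1.2.1 0, q.1.2.2.1 1, -q.1.2.2.1 2, q.1.1, q.1.2.1 2 / 2, q.1.2.1 1 / 2,
    -q.1.2.2.1 0 / 2]
  left_inv p := by
    funext i
    fin_cases i <;> simp
  right_inv q := by
    obtain ⟨⟨a, u, v, b⟩, hq⟩ := q
    have hb : b = -a := by
      have : (a + b) / 2 = 0 := hq
      linarith
    subst hb
    refine Subtype.ext (Prod.ext rfl (Prod.ext ?_ (Prod.ext ?_ rfl)))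
    · change ![u 0, 2 * (u 1 / 2), 2 * (u 2 / 2)] = u
      funext i
      fin_cases i <;> simp [mul_div_cancel₀]
    · change ![-2 * (-v 0 / 2), v 1, - -v 2] = v
      funext i
      fin_cases i <;> simp [mul_div_cancel₀]

/-- The three-form on `ℝ⁷` which is invariant under the irreducible `SL₂` with Lie algebra
`⟨sl2X, sl2H, sl2Y⟩`. -/
noncomputable def invariantForm : (Fin 7 → ℝ) [⋀^Fin 3]→ₗ[ℝ] ℝ :=
  splitG2Form.compLinearMap imSplitOctEquiv.toLinearMap

theorem invariantForm_apply (p q r : Fin 7 → ℝ) : invariantForm ![p, q, r] =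
    (p 3 * (q 0 * (-2 * r 6) + 2 * q 5 * r 1 - 2 * q 4 * r 2
        - r 0 * (-2 * q 6) - 2 * r 5 * q 1 + 2 * r 4 * q 2)
      - q 3 * (p 0 * (-2 * r 6) + 2 * p 5 * r 1 - 2 * p 4 * r 2
        - r 0 * (-2 * p 6) - 2 * r 5 * p 1 + 2 * r 4 * p 2)
      + r 3 * (p 0 * (-2 * q 6) + 2 * p 5 * q 1 - 2 * p 4 * q 2
        - q 0 * (-2 * p 6) - 2 * q 5 * p 1 + 2 * q 4 * p 2)) / 2
      + 2 * (p 0 * (q 5 * r 4 - q 4 * r 5) - p 5 * (q 0 * r 4 - q 4 * r 0)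
        + p 4 * (q 0 * r 5 - q 5 * r 0))
      - (p 6 * (q 1 * r 2 - q 2 * r 1) - p 1 * (q 6 * r 2 - q 2 * r 6)
        + p 2 * (q 6 * r 1 - q 1 * r 6)) := by
  simp [invariantForm, splitG2Form, imSplitOctEquiv, SplitOct.mul, SplitOct.re, crossProduct,
    dotProduct, Fin.sum_univ_three]
  ring

theorem formAction_three {n : Type*} [Fintype n] (Ω : (n → ℝ) [⋀^Fin 3]→ₗ[ℝ] ℝ)
    (u : Fin 3 → n → ℝ) (M : Matrix n n ℝ) : formAction Ω u M =
      Ω ![M *ᵥ u 0, u 1, u 2] + Ω ![u 0, M *ᵥ u 1, u 2] + Ω ![u 0, u 1, M *ᵥ u 2] := by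
  rw [formAction_apply, Fin.sum_univ_three]
  congr 3 <;> ext1 i <;> fin_cases i <;> rfl

theorem sl2X_mulVec (p : Fin 7 → ℝ) : sl2X *ᵥ p = ![0, p 0, p 1, p 2, p 3, p 4, p 5] := by
  ext i
  fin_cases i <;> simp [sl2X, Matrix.mulVec, dotProduct, Fin.sum_univ_seven]

theorem sl2H_mulVec (p : Fin 7 → ℝ) :
    sl2H *ᵥ p = ![6 * p 0, 4 * p 1, 2 * p 2, 0, -2 * p 4, -4 * p 5, -6 * p 6] := by
  ext i
  fin_cases i <;> norm_num [sl2H, Matrix.mulVec_diagonal] <;> rfl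

theorem sl2Y_mulVec (p : Fin 7 → ℝ) :
    sl2Y *ᵥ p = ![6 * p 1, 10 * p 2, 12 * p 3, 12 * p 4, 10 * p 5, 6 * p 6, 0] := by
  ext i
  fin_cases i <;> norm_num [sl2Y, Matrix.mulVec, dotProduct, Fin.sum_univ_seven]

theorem formAction_invariantForm_sl2X (u : Fin 3 → Fin 7 → ℝ) :
    formAction invariantForm u sl2X = 0 := by
  simp only [formAction_three, sl2X_mulVec, invariantForm_apply, Matrix.cons_val]
  ring

theorem formAction_invariantForm_sl2H (u : Fin 3 → Fin 7 → ℝ) :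
    formAction invariantForm u sl2H = 0 := by
  simp only [formAction_three, sl2H_mulVec, invariantForm_apply, Matrix.cons_val]
  ring

theorem formAction_invariantForm_sl2Y (u : Fin 3 → Fin 7 → ℝ) :
    formAction invariantForm u sl2Y = 0 := by
  simp only [formAction_three, sl2Y_mulVec, invariantForm_apply, Matrix.cons_val]
  ring

theorem formAction_invariantForm_sl2Y_pow_five (u : Fin 3 → Fin 7 → ℝ) :
    formAction invariantForm u (sl2Y ^ 5) = 0 := by
  simp only [formAction_three, pow_succ, pow_zero, one_mul, ← Matrix.mulVec_mulVec,
    sl2Y_mulVec, invariantForm_apply, Matrix.cons_val]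
  ring

end InvariantForm

section WeightVectors

/-- The standard basis of `ℝ⁷` as weight vectors of `sl2H`, extended by zero to all indices. -/
def weightVector (n : ℕ) : Fin 7 → ℝ := fun i => if (i : ℕ) = n then 1 else 0

theorem weightVector_of_le {n : ℕ} (h : 7 ≤ n) : weightVector n = 0 :=
  funext fun i => if_neg (by omega)

theorem weightVector_eq_single (i : Fin 7) : weightVector i = Pi.single i 1 := by
  ext j
  simp [weightVector, Pi.single_apply, Fin.ext_iff]

theorem sl2X_mulVec_weightVector (n : ℕ) : sl2X *ᵥ weightVector n = weightVector (n + 1) := by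
  obtain h | h := lt_or_ge n 7
  · rw [sl2X_mulVec]
    interval_cases n <;> ext i <;> fin_cases i <;> simp [weightVector]
  · rw [weightVector_of_le h, weightVector_of_le (by omega), Matrix.mulVec_zero]

theorem sl2H_mulVec_weightVector (n : ℕ) :
    sl2H *ᵥ weightVector n = (6 - 2 * n : ℝ) • weightVector n := by
  ext i
  rw [sl2H, Matrix.mulVec_diagonal, Pi.smul_apply, smul_eq_mul, weightVector]
  split_ifs with h
  · rw [h]
  · simp only [mul_zero]

theorem sl2Y_mulVec_weightVector (n : ℕ) :
    sl2Y *ᵥ weightVector n = (n * (7 - n) : ℝ) • weightVector (n - 1) := by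
  obtain h | h := lt_or_ge n 7
  · rw [sl2Y_mulVec]
    interval_cases n <;> ext i <;> fin_cases i <;> norm_num [weightVector]
  · rw [weightVector_of_le h, Matrix.mulVec_zero]
    obtain rfl | h := h.eq_or_lt
    · simp
    · rw [weightVector_of_le (by omega), smul_zero]

theorem sl2Y_pow_mulVec_weightVector (m n : ℕ) : sl2Y ^ m *ᵥ weightVector n =
    (∏ l ∈ Finset.range m, (n - l : ℝ) * (7 - (n - l))) • weightVector (n - m) := by
  induction m with
  | zero => simp
  | succ m ih =>
    rw [pow_succ', ← Matrix.mulVec_mulVec, ih, Matrix.mulVec_smul, sl2Y_mulVec_weightVector,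
      smul_smul, Finset.prod_range_succ, Nat.sub_sub]
    obtain h | h := le_or_gt m n
    · rw [Nat.cast_sub h]
    · have h0 : ∏ l ∈ Finset.range m, (n - l : ℝ) * (7 - (n - l)) = 0 :=
        Finset.prod_eq_zero (Finset.mem_range.2 h) (by simp)
      simp [h0]

end WeightVectors

/-! ## Components of three-forms by weight -/

section Components

variable (g : (Fin 7 → ℝ) [⋀^Fin 3]→ₗ[ℝ] ℝ)

/-- The triple of weight vectors with indices `i`, `j`, `k`; the values of a three-form on these
triples are its components, the component of index `(i, j, k)` having `sl2H`-weight
`18 - 2 * (i + j + k)`. -/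
def weightTriple (i j k : ℕ) : Fin 3 → Fin 7 → ℝ :=
  ![weightVector i, weightVector j, weightVector k]

theorem map_weightTriple_swap_left (i j k : ℕ) :
    g (weightTriple j i k) = -g (weightTriple i j k) := by
  rw [← g.map_swap (weightTriple i j k) (show (0 : Fin 3) ≠ 1 by decide)]
  congr 1
  ext l
  fin_cases l <;> rfl

theorem map_weightTriple_swap_right (i j k : ℕ) :
    g (weightTriple i k j) = -g (weightTriple i j k) := by
  rw [← g.map_swap (weightTriple i j k) (show (1 : Fin 3) ≠ 2 by decide)]
  congr 1
  ext l
  fin_cases l <;> rfl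

theorem map_weightTriple_of_le (i j : ℕ) {k : ℕ} (hk : 7 ≤ k) : g (weightTriple i j k) = 0 :=
  g.map_coord_zero 2 (weightVector_of_le hk)

variable {g}

theorem eq_zero_of_map_weightTriple (h : ∀ i j k, g (weightTriple i j k) = 0) : g = 0 := by
  refine (Pi.basisFun ℝ (Fin 7)).ext_alternating fun v _ => ?_
  rw [AlternatingMap.zero_apply]
  convert h (v 0) (v 1) (v 2) using 2
  ext l
  fin_cases l <;> simp [weightTriple, weightVector_eq_single]

variable (g)

theorem formAction_weightTriple {M : Matrix (Fin 7) (Fin 7) ℝ} {c : ℕ → ℝ} {s : ℕ → ℕ}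
    (hM : ∀ n, M *ᵥ weightVector n = c n • weightVector (s n)) (i j k : ℕ) :
    formAction g (weightTriple i j k) M = c i * g (weightTriple (s i) j k) +
      c j * g (weightTriple i (s j) k) + c k * g (weightTriple i j (s k)) := by
  have hsmul (a b c : ℝ) (p q r : Fin 7 → ℝ) :
      g ![a • p, b • q, c • r] = a * b * c * g ![p, q, r] := by
    have h := g.map_smul_univ ![a, b, c] ![p, q, r]
    rw [Fin.prod_univ_three] at h
    refine (congrArg g ?_).trans h
    ext1 l
    fin_cases l <;> rfl
  have h1 := hsmul (c i) 1 1
  have h2 := hsmul 1 (c j) 1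
  have h3 := hsmul 1 1 (c k)
  simp only [one_smul, one_mul, mul_one] at h1 h2 h3
  simp only [weightTriple, formAction_three, Matrix.cons_val, hM, h1, h2, h3]

theorem formAction_weightTriple_sl2X (i j k : ℕ) : formAction g (weightTriple i j k) sl2X =
    g (weightTriple (i + 1) j k) + g (weightTriple i (j + 1) k) + g (weightTriple i j (k + 1)) := by
  simpa using formAction_weightTriple g (c := 1) (s := (· + 1))
    (fun n => by simp [sl2X_mulVec_weightVector]) i j k

theorem formAction_weightTriple_sl2H (i j k : ℕ) : formAction g (weightTriple i j k) sl2H =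
    (18 - 2 * (i + j + k)) * g (weightTriple i j k) := by
  rw [formAction_weightTriple g (s := id) sl2H_mulVec_weightVector, id, id, id]
  ring

theorem formAction_weightTriple_sl2Y_pow (m i j k : ℕ) :
    formAction g (weightTriple i j k) (sl2Y ^ m) =
      (∏ l ∈ Finset.range m, (i - l : ℝ) * (7 - (i - l))) * g (weightTriple (i - m) j k) +
      (∏ l ∈ Finset.range m, (j - l : ℝ) * (7 - (j - l))) * g (weightTriple i (j - m) k) +
      (∏ l ∈ Finset.range m, (k - l : ℝ) * (7 - (k - l))) * g (weightTriple i j (k - m)) :=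
  formAction_weightTriple g (sl2Y_pow_mulVec_weightVector m) i j k

variable {g} {i j k : ℕ}

theorem formAction_weightTriple_sl2Y_pow_eq_zero {m : ℕ}
    (hg : ∀ i' j' k', i' + j' + k' + m = i + j + k → g (weightTriple i' j' k') = 0) :
    formAction g (weightTriple i j k) (sl2Y ^ m) = 0 := by
  have hterm (n : ℕ) {x : ℝ} (hx : m ≤ n → x = 0) :
      (∏ l ∈ Finset.range m, (n - l : ℝ) * (7 - (n - l))) * x = 0 := by
    obtain hn | hn := lt_or_ge n m
    · exact mul_eq_zero_of_left (Finset.prod_eq_zero (Finset.mem_range.2 hn) (by simp)) x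
    · exact mul_eq_zero_of_right _ (hx hn)
  rw [formAction_weightTriple_sl2Y_pow, hterm i fun _ => hg _ _ _ (by omega),
    hterm j fun _ => hg _ _ _ (by omega), hterm k fun _ => hg _ _ _ (by omega), add_zero, add_zero]

end Components

section Raising

variable {f : ℕ → ℕ → ℕ → ℝ}

theorem zero_three_eq_zero_of_raising_eq_zero (hl : ∀ i j k, f j i k = -f i j k)
    (hr : ∀ i j k, f i k j = -f i j k) (hlarge : ∀ i j k, 7 ≤ k → f i j k = 0)
    (h01 : ∀ k, f 0 1 k = 0) (h036 : f 0 3 6 = 0)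
    (hX : ∀ i j k, f (i + 1) j k + f i (j + 1) k + f i j (k + 1) = 0) (k : ℕ) :
    f 0 2 k = 0 ∧ f 0 3 k = 0 ∧ f 0 4 k = 0 := by
  have h02 (k) : f 0 2 k = 0 := by linarith [hX 0 1 k, hl 1 1 k, h01 (k + 1)]
  have h12 (k) : f 1 2 k = -f 0 3 k := by linarith [hX 0 2 k, h02 (k + 1)]
  have h04 (k) : f 0 4 k = -2 * f 0 3 (k + 1) := by
    linarith [hX 0 3 k, hX 1 2 k, hl 2 2 k, h12 (k + 1)]
  have h03 (k) : f 0 3 k = 0 := by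
    obtain hk | hk := lt_or_ge k 7
    · interval_cases k
      · linarith [hr 0 0 3, hl 0 0 3]
      · linarith [hr 0 1 3, h01 3]
      · linarith [hr 0 2 3, h02 3]
      · linarith [hr 0 3 3]
      · linarith [hr 0 3 4, h04 3]
      · linarith [hr 0 4 4, h04 4]
      · exact h036
    · exact hlarge 0 3 k hk
  exact ⟨h02 k, h03 k, by rw [h04, h03, mul_zero]⟩

theorem eq_zero_of_raising_eq_zero (hl : ∀ i j k, f j i k = -f i j k)
    (hr : ∀ i j k, f i k j = -f i j k) (hlarge : ∀ i j k, 7 ≤ k → f i j k = 0)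
    (h01 : ∀ k, f 0 1 k = 0) (h036 : f 0 3 6 = 0)
    (hX : ∀ i j k, f (i + 1) j k + f i (j + 1) k + f i j (k + 1) = 0) (i j k : ℕ) :
    f i j k = 0 := by
  have h (k) := zero_three_eq_zero_of_raising_eq_zero hl hr hlarge h01 h036 hX k
  have h056 : f 0 5 6 = 0 := by
    linarith [hX 0 4 6, hX 1 3 6, hX 2 3 5, hX 1 4 5, hl 3 3 5, hr 1 5 5, (h 7).2.2,
      hlarge 1 3 7 le_rfl]
  induction i generalizing j k with
  | zero =>
    obtain hk | hk := lt_or_ge k 7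
    · obtain hj | hj := lt_or_ge j 7
      · interval_cases j
        · linarith [hl 0 0 k]
        · exact h01 k
        · exact (h k).1
        · exact (h k).2.1
        · exact (h k).2.2
        all_goals
          interval_cases k <;> linarith [hl 0 0 5, hl 0 0 6, hr 0 0 5, hr 0 0 6, hr 0 1 5, hr 0 1 6,
            h01 5, h01 6, hr 0 2 5, hr 0 2 6, hr 0 3 5, hr 0 3 6, hr 0 4 5, hr 0 4 6, hr 0 5 5,
            hr 0 5 6, hr 0 6 6, (h 5).1, (h 5).2.1, (h 5).2.2, (h 6).1, (h 6).2.1, (h 6).2.2]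
      · rw [hr, hlarge 0 k j hj, neg_zero]
    · exact hlarge 0 j k hk
  | succ i ih => linarith [hX i j k, ih (j + 1) k, ih j (k + 1)]

end Raising

section InvariantFormComponents

theorem invariantForm_weightTriple_zero_three_six : invariantForm (weightTriple 0 3 6) = 1 := by
  simp [weightTriple, invariantForm_apply, weightVector]

theorem invariantForm_weightTriple_zero_one (k : ℕ) : invariantForm (weightTriple 0 1 k) = 0 := by
  simp [weightTriple, invariantForm_apply, weightVector]

theorem IsG2Structure.ne_zero {Ω : (Fin 7 → ℝ) [⋀^Fin 3]→ₗ[ℝ] ℝ} (hΩ : IsG2Structure Ω) :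
    Ω ≠ 0 := by
  obtain ⟨φ, rfl⟩ := hΩ
  intro h
  have hω : invariantForm = 0 := by
    ext v
    simpa using! DFunLike.congr_fun h (fun i => φ.symm (imSplitOctEquiv (v i)))
  simpa [hω] using invariantForm_weightTriple_zero_three_six

theorem invariantForm_weightTriple_eq_zero {i j k : ℕ} (h : i + j + k ≠ 9) :
    invariantForm (weightTriple i j k) = 0 := by
  have hH := formAction_weightTriple_sl2H invariantForm i j k
  rw [formAction_invariantForm_sl2H, eq_comm, mul_eq_zero, sub_eq_zero] at hH
  refine hH.resolve_left fun h9 => h ?_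
  have : ((i + j + k : ℕ) : ℝ) = (9 : ℕ) := by
    push_cast
    linarith
  exact_mod_cast this

theorem formAction_invariantForm_sl2Y_pow_eq_zero {m i j k : ℕ} (h : i + j + k ≠ 9 + m) :
    formAction invariantForm (weightTriple i j k) (sl2Y ^ m) = 0 :=
  formAction_weightTriple_sl2Y_pow_eq_zero fun _ _ _ h' =>
    invariantForm_weightTriple_eq_zero (by omega)

variable {g : (Fin 7 → ℝ) [⋀^Fin 3]→ₗ[ℝ] ℝ} {c : ℝ}

/-- For `m = 0, 2, 3, 4, 6` the evaluation of an array of components at the lowest weight vector of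
weight `-2 * m` in `Λ³ ℝ⁷ = V₁₂ ⊕ V₈ ⊕ V₆ ⊕ V₄ ⊕ V₀`. As `sl2X` kills this vector, the functional
separates the forms obtained by the action of `sl2Y ^ m` on `invariantForm` from those obtained by
the action of `sl2X`. -/
def raisingAnnihilator (m : ℕ) (T : ℕ → ℕ → ℕ → ℝ) : ℝ :=
  match m with
  | 0 => T 0 3 6 - 2 * T 1 2 6 + T 1 3 5 - T 0 4 5 - T 2 3 4
  | 2 => T 0 5 6 - T 1 4 6 + T 2 3 6
  | 3 => T 1 5 6 - T 2 4 6 + T 3 4 5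
  | 4 => T 2 5 6 - T 3 4 6
  | 6 => T 4 5 6
  | _ => 0

theorem raisingAnnihilator_sl2X (g : (Fin 7 → ℝ) [⋀^Fin 3]→ₗ[ℝ] ℝ) (m : ℕ) :
    raisingAnnihilator m (fun i j k => formAction g (weightTriple i j k) sl2X) = 0 := by
  have hlarge := map_weightTriple_of_le g
  have hl := map_weightTriple_swap_left g
  have hr := map_weightTriple_swap_right g
  unfold raisingAnnihilator
  simp only [formAction_weightTriple_sl2X, Nat.reduceAdd]
  split
  · linarith [hlarge 0 3 le_rfl, hlarge 1 2 le_rfl, hl 2 2 6, hr 1 5 5, hr 2 4 4,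
      hr 0 5 5, hl 3 3 4, hr 1 4 5]
  · linarith [hr 0 6 6, hlarge 0 5 le_rfl, hlarge 1 4 le_rfl, hl 3 3 6, hlarge 2 3 le_rfl]
  · linarith [hr 1 6 6, hlarge 1 5 le_rfl, hlarge 2 4 le_rfl, hl 4 4 5, hr 3 5 5]
  · linarith [hr 2 6 6, hlarge 2 5 le_rfl, hl 4 4 6, hlarge 3 4 le_rfl]
  · linarith [hl 5 5 6, hr 4 6 6, hlarge 4 5 le_rfl]
  · rfl

theorem raisingAnnihilator_invariantForm_ne_zero {m : ℕ} (hm : m ∈ ({0, 2, 3, 4, 6} : Finset ℕ)) :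
    raisingAnnihilator m
      (fun i j k => formAction invariantForm (weightTriple i j k) (sl2Y ^ m)) ≠ 0 := by
  fin_cases hm <;>
    simp only [raisingAnnihilator, formAction_weightTriple_sl2Y_pow, Finset.prod_range_succ] <;>
    norm_num [weightTriple, invariantForm_apply, weightVector]

theorem coeff_eq_zero_of_formAction_sl2X_eq {m : ℕ} (hm : m ∈ ({0, 2, 3, 4, 6} : Finset ℕ))
    (h : ∀ i j k, i + j + k = 9 + m → formAction g (weightTriple i j k) sl2X =
      c * formAction invariantForm (weightTriple i j k) (sl2Y ^ m)) : c = 0 := by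
  have hc : c * raisingAnnihilator m
      (fun i j k => formAction invariantForm (weightTriple i j k) (sl2Y ^ m)) = 0 := by
    rw [← raisingAnnihilator_sl2X g m]
    fin_cases hm <;> simp only [raisingAnnihilator, h, Nat.reduceAdd, add_zero] <;> ring
  exact (mul_eq_zero.1 hc).resolve_right (raisingAnnihilator_invariantForm_ne_zero hm)

theorem formAction_sl2X_eq_zero_of_eq_sum {w : ℕ} {c : ℕ → ℝ}
    (h : ∀ i j k, i + j + k = w → formAction g (weightTriple i j k) sl2X =
      ∑ m ∈ Finset.range 7, c m * formAction invariantForm (weightTriple i j k) (sl2Y ^ m))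
    {i j k : ℕ} (hw : i + j + k = w) : formAction g (weightTriple i j k) sl2X = 0 := by
  by_cases hm : ∃ m < 7, w = 9 + m
  · obtain ⟨m, hm, rfl⟩ := hm
    have hsum {i j k} (hw : i + j + k = 9 + m) : formAction g (weightTriple i j k) sl2X =
        c m * formAction invariantForm (weightTriple i j k) (sl2Y ^ m) := by
      rw [h i j k hw, Finset.sum_eq_single_of_mem m (Finset.mem_range.2 hm)]
      intro l _ hl
      rw [formAction_invariantForm_sl2Y_pow_eq_zero (by omega), mul_zero]
    rw [hsum hw]
    by_cases hm' : m ∈ ({0, 2, 3, 4, 6} : Finset ℕ)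
    · rw [coeff_eq_zero_of_formAction_sl2X_eq hm' fun i j k hw => hsum hw, zero_mul]
    · obtain rfl | rfl : m = 1 ∨ m = 5 := by
        simp only [Finset.mem_insert, Finset.mem_singleton] at hm'
        omega
      · rw [pow_one, formAction_invariantForm_sl2Y, mul_zero]
      · rw [formAction_invariantForm_sl2Y_pow_five, mul_zero]
  · rw [h i j k hw]
    refine Finset.sum_eq_zero fun m hm' => ?_
    have hne : w ≠ 9 + m := fun hw' => hm ⟨m, Finset.mem_range.1 hm', hw'⟩
    rw [formAction_invariantForm_sl2Y_pow_eq_zero (by omega), mul_zero]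

end InvariantFormComponents

/-! ## Compatibility and the Wilczynski invariants -/

section CanonicalMatrix

/-- The general value of `F⁻¹ F'` for a canonical frame `F`, with the coefficients `b` and `c` of
`sl2H` and `sl2Y` that a canonical frame leaves free. -/
def canonicalMatrix (b c : ℝ) (θ : ℕ → ℝ) : Matrix (Fin 7) (Fin 7) ℝ :=
  sl2X + b • sl2H + c • sl2Y + ∑ m ∈ Finset.Icc 3 7, θ m • sl2Y ^ (m - 1)

variable {b c : ℝ} {θ : ℕ → ℝ}

theorem formAction_canonicalMatrix (g : (Fin 7 → ℝ) [⋀^Fin 3]→ₗ[ℝ] ℝ) (u : Fin 3 → Fin 7 → ℝ) :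
    formAction g u (canonicalMatrix b c θ) =
      formAction g u sl2X + b * formAction g u sl2H + c * formAction g u sl2Y +
        ∑ m ∈ Finset.Icc 3 7, θ m * formAction g u (sl2Y ^ (m - 1)) := by
  simp only [canonicalMatrix, map_add, map_smul, map_sum, smul_eq_mul]

theorem formAction_invariantForm_canonicalMatrix (u : Fin 3 → Fin 7 → ℝ) :
    formAction invariantForm u (canonicalMatrix b c θ) =
      ∑ m ∈ Finset.Icc 3 7, θ m * formAction invariantForm u (sl2Y ^ (m - 1)) := by
  rw [formAction_canonicalMatrix, formAction_invariantForm_sl2X, formAction_invariantForm_sl2H,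
    formAction_invariantForm_sl2Y, mul_zero, mul_zero, add_zero, add_zero, zero_add]

theorem formAction_weightTriple_canonicalMatrix {g : (Fin 7 → ℝ) [⋀^Fin 3]→ₗ[ℝ] ℝ} {i j k : ℕ}
    (hg : ∀ i' j' k', i' + j' + k' ≤ i + j + k → g (weightTriple i' j' k') = 0) :
    formAction g (weightTriple i j k) (canonicalMatrix b c θ) =
      formAction g (weightTriple i j k) sl2X := by
  have hY (m : ℕ) : formAction g (weightTriple i j k) (sl2Y ^ m) = 0 :=
    formAction_weightTriple_sl2Y_pow_eq_zero fun i' j' k' h => hg i' j' k' (by omega)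
  have hY1 := hY 1
  rw [pow_one] at hY1
  rw [formAction_canonicalMatrix, formAction_weightTriple_sl2H, hg i j k le_rfl, hY1,
    Finset.sum_eq_zero fun m _ => by rw [hY, mul_zero]]
  ring

theorem formAction_invariantForm_canonicalMatrix_of_weight {m i j k : ℕ} (hm2 : 2 ≤ m)
    (hm6 : m ≤ 6) (hw : i + j + k = 9 + m) :
    formAction invariantForm (weightTriple i j k) (canonicalMatrix b c θ) =
      θ (m + 1) * formAction invariantForm (weightTriple i j k) (sl2Y ^ m) := by
  rw [formAction_invariantForm_canonicalMatrix,
    Finset.sum_eq_single_of_mem (m + 1) (Finset.mem_Icc.2 (by omega)), Nat.add_sub_cancel]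
  intro l hl hlm
  have := Finset.mem_Icc.1 hl
  rw [formAction_invariantForm_sl2Y_pow_eq_zero (by omega), mul_zero]

theorem formAction_invariantForm_canonicalMatrix_eq_zero (h3 : θ 3 = 0) (h4 : θ 4 = 0)
    (h5 : θ 5 = 0) (h7 : θ 7 = 0) (u : Fin 3 → Fin 7 → ℝ) :
    formAction invariantForm u (canonicalMatrix b c θ) = 0 := by
  rw [formAction_invariantForm_canonicalMatrix]
  simp [Finset.sum_Icc_succ_top, h3, h4, h5, h7, formAction_invariantForm_sl2Y_pow_five]

variable {g : (Fin 7 → ℝ) [⋀^Fin 3]→ₗ[ℝ] ℝ} {w : ℕ}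

theorem formAction_sl2X_eq_zero_of_canonicalMatrix {l l' : ℝ}
    (hg : ∀ i j k, i + j + k ≤ w → g (weightTriple i j k) = 0)
    (hA : ∀ i j k, i + j + k = w → formAction g (weightTriple i j k) (canonicalMatrix b c θ) =
      l' * invariantForm (weightTriple i j k) -
        l * formAction invariantForm (weightTriple i j k) (canonicalMatrix b c θ))
    {i j k : ℕ} (hw : i + j + k = w) : formAction g (weightTriple i j k) sl2X = 0 := by
  refine formAction_sl2X_eq_zero_of_eq_sum
    (c := fun m => if m = 0 then l' / 3 else if m = 1 then 0 else -l * θ (m + 1))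
    (fun i j k hw => ?_) hw
  have hone : formAction invariantForm (weightTriple i j k) 1 =
      3 * invariantForm (weightTriple i j k) := by
    rw [formAction_one, Fintype.card_fin, Nat.cast_ofNat]
  have hX := hA i j k hw
  rw [formAction_weightTriple_canonicalMatrix (hw ▸ hg),
    formAction_invariantForm_canonicalMatrix] at hX
  rw [hX]
  simp only [Finset.sum_Icc_succ_top, Finset.Icc_self, Finset.sum_singleton, Finset.sum_range_succ,
    Finset.sum_range_zero, Nat.reduceLeDiff, Nat.reduceAdd, Nat.reduceSub, Nat.reduceEqDiff,
    OfNat.ofNat_ne_zero, one_ne_zero, if_true, if_false, pow_zero, hone]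
  ring

theorem map_weightTriple_eq_zero_of_formAction_sl2X (h01 : ∀ k, g (weightTriple 0 1 k) = 0)
    (h036 : g (weightTriple 0 3 6) = 0)
    (hX : ∀ i j k, i + j + k = w → formAction g (weightTriple i j k) sl2X = 0)
    {i j k : ℕ} (hw : i + j + k = w + 1) : g (weightTriple i j k) = 0 := by
  let f (i j k : ℕ) : ℝ := if i + j + k = w + 1 then g (weightTriple i j k) else 0
  have hf : f i j k = 0 := by
    refine eq_zero_of_raising_eq_zero (fun i j k => ?_) (fun i j k => ?_) (fun i j k hk => ?_)
      (fun k => ?_) ?_ (fun i j k => ?_) i j k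
    · simp only [f, add_comm j i, map_weightTriple_swap_left g i j k]
      split_ifs <;> simp
    · simp only [f, add_right_comm i k j, map_weightTriple_swap_right g i j k]
      split_ifs <;> simp
    · simp only [f, map_weightTriple_of_le g i j hk, ite_self]
    · simp only [f, h01, ite_self]
    · simp only [f, h036, ite_self]
    · by_cases hw : i + j + k = w
      · simpa [f, ← hw, add_right_comm, add_assoc, formAction_weightTriple_sl2X] using hX i j k hw
      · simp only [f]
        rw [if_neg (by omega), if_neg (by omega), if_neg (by omega), add_zero, add_zero]
  simpa only [f, if_pos hw] using hf

theorem canonicalMatrix_mulVec_weightVector_zero :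
    canonicalMatrix b c θ *ᵥ weightVector 0 = weightVector 1 + (6 * b) • weightVector 0 := by
  have hY : ∀ m ∈ Finset.Icc 3 7, θ m • sl2Y ^ (m - 1) *ᵥ weightVector 0 = 0 := fun m hm => by
    have hm' : 0 < m - 1 := by have := (Finset.mem_Icc.1 hm).1; omega
    rw [sl2Y_pow_mulVec_weightVector,
      Finset.prod_eq_zero (Finset.mem_range.2 hm') (by simp), zero_smul, smul_zero]
  simp only [canonicalMatrix, Matrix.add_mulVec, Matrix.smul_mulVec, Matrix.sum_mulVec,
    sl2X_mulVec_weightVector, sl2H_mulVec_weightVector, sl2Y_mulVec_weightVector]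
  rw [Finset.sum_eq_zero hY]
  simp [smul_smul, mul_comm]

end CanonicalMatrix

theorem formAction_sub_smul_eq {n ι : Type*} [Fintype n] [Fintype ι] [DecidableEq ι]
    {f : ℝ → (n → ℝ) [⋀^ι]→ₗ[ℝ] ℝ} {Ω' : (n → ℝ) [⋀^ι]→ₗ[ℝ] ℝ} {l : ℝ → ℝ} {l' : ℝ}
    {u : ι → n → ℝ} {A : Matrix n n ℝ} {t : ℝ}
    (hf : HasDerivAt (fun s => f s u) (formAction (f t) u A) t) (hl : HasDerivAt l l' t)
    (hzero : ∀ᶠ s in nhds t, (f s - l s • Ω') u = 0) :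
    formAction (f t - l t • Ω') u A = l' * Ω' u - l t * formAction Ω' u A := by
  have hderiv : formAction (f t) u A = l' * Ω' u :=
    hf.unique ((hl.mul_const (Ω' u)).congr_of_eventuallyEq
      (hzero.mono fun s hs => sub_eq_zero.1 hs))
  rw [formAction_sub, formAction_smul, LinearMap.sub_apply, LinearMap.smul_apply, smul_eq_mul,
    hderiv]

namespace IsCanonicalFrame

variable {γ : ℝ → ℙ ℝ (Fin 7 → ℝ)} {I : Set ℝ} {F : ℝ → Matrix (Fin 7) (Fin 7) ℝ}
  {θ : ℕ → ℝ → ℝ} {Ω : (Fin 7 → ℝ) [⋀^Fin 3]→ₗ[ℝ] ℝ} {t : ℝ}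

theorem hasDerivAt (hF : IsCanonicalFrame γ I F θ) (ht : t ∈ I) :
    ∃ b c, HasDerivAt F (F t * canonicalMatrix b c fun m => θ m t) t := by
  obtain ⟨b, c, h⟩ := hF.structure_eq t ht
  exact ⟨b, c, hasDerivAt_matrix.2 h⟩

theorem isSmoothLift (hF : IsCanonicalFrame γ I F θ) :
    IsSmoothLift γ I fun t => F t *ᵥ weightVector 0 := by
  have hcol (t) : F t *ᵥ weightVector 0 = fun i => F t i 0 := by
    change F t *ᵥ weightVector (0 : Fin 7) = _
    rw [weightVector_eq_single, Matrix.mulVec_single_one]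
    rfl
  simp only [hcol]
  exact ⟨contDiffOn_pi.2 fun i => hF.smooth i 0, hF.lifts⟩

theorem isUnit_det (hF : IsCanonicalFrame γ I F θ) (ht : t ∈ I) : IsUnit (F t).det := by
  rw [hF.det_eq_one t ht]
  exact isUnit_one

theorem isCompatible_iff (hI : IsOpen I) (hF : IsCanonicalFrame γ I F θ) :
    IsCompatible γ I Ω ↔
      ∀ t ∈ I, ∀ w, Ω ![F t *ᵥ weightVector 0, F t *ᵥ weightVector 1, w] = 0 := by
  refine (hF.isSmoothLift.isCompatible_iff hI Ω).trans (forall₃_congr fun t ht w => ?_)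
  obtain ⟨b, c, hFt⟩ := hF.hasDerivAt ht
  have hderiv := (hasDerivAt_mulVec hFt (weightVector 0)).deriv
  rw [← Matrix.mulVec_mulVec, canonicalMatrix_mulVec_weightVector_zero, Matrix.mulVec_add,
    Matrix.mulVec_smul] at hderiv
  have hdup : Ω ![F t *ᵥ weightVector 0, F t *ᵥ weightVector 0, w] = 0 :=
    Ω.map_eq_zero_of_eq _ (i := 0) (j := 1) rfl (by decide)
  rw [hderiv, ← AlternatingMap.curryLeft_apply_apply, AlternatingMap.map_vecCons_add,
    AlternatingMap.map_vecCons_smul, AlternatingMap.curryLeft_apply_apply,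
    AlternatingMap.curryLeft_apply_apply, hdup, smul_zero, add_zero]

theorem exists_hasDerivAt_formAction (hF : IsCanonicalFrame γ I F θ) (ht : t ∈ I) :
    ∃ b c, ∀ u, HasDerivAt (fun s => Ω.compLinearMap (F s).mulVecLin u)
      (formAction (Ω.compLinearMap (F t).mulVecLin) u (canonicalMatrix b c fun m => θ m t)) t := by
  obtain ⟨b, c, hFt⟩ := hF.hasDerivAt ht
  exact ⟨b, c, fun u => hasDerivAt_form_mulVec Ω u hFt⟩

theorem compLinearMap_eq_smul_invariantForm (hI : IsOpen I) (hF : IsCanonicalFrame γ I F θ)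
    (hΩ : IsCompatible γ I Ω) (ht : t ∈ I) : Ω.compLinearMap (F t).mulVecLin =
      Ω.compLinearMap (F t).mulVecLin (weightTriple 0 3 6) • invariantForm := by
  let f (t : ℝ) := Ω.compLinearMap (F t).mulVecLin
  let g (t : ℝ) := f t - f t (weightTriple 0 3 6) • invariantForm
  have hg01 {t} (ht : t ∈ I) (k : ℕ) : g t (weightTriple 0 1 k) = 0 := by
    have hf : f t (weightTriple 0 1 k) = 0 := by
      refine Eq.trans (congrArg Ω ?_) ((hF.isCompatible_iff hI).1 hΩ t ht (F t *ᵥ weightVector k))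
      ext1 l
      fin_cases l <;> rfl
    simp [g, hf, invariantForm_weightTriple_zero_one]
  have hg036 (t) : g t (weightTriple 0 3 6) = 0 := by
    simp [g, invariantForm_weightTriple_zero_three_six]
  have hg (w : ℕ) : ∀ t ∈ I, ∀ i j k, i + j + k ≤ w → g t (weightTriple i j k) = 0 := by
    induction w with
    | zero =>
      intro t _ i j k h
      exact (g t).map_eq_zero_of_eq _ (i := 0) (j := 1)
        (congrArg weightVector (show i = j by omega)) (by decide)
    | succ w ih =>
      intro t ht i j k h
      obtain h | h := h.lt_or_eq
      · exact ih t ht i j k (by omega)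
      obtain ⟨b, c, hderiv⟩ := hF.exists_hasDerivAt_formAction (Ω := Ω) ht
      have hA (i j k : ℕ) (hw : i + j + k = w) :=
        formAction_sub_smul_eq (hderiv (weightTriple i j k)) (hderiv (weightTriple 0 3 6)) <|
          Filter.eventually_of_mem (hI.mem_nhds ht) fun s hs => ih s hs i j k hw.le
      exact map_weightTriple_eq_zero_of_formAction_sl2X (hg01 ht) (hg036 t)
        (fun i j k hw => formAction_sl2X_eq_zero_of_canonicalMatrix (ih t ht) hA hw) h
  exact sub_eq_zero.1 (eq_zero_of_map_weightTriple fun i j k => hg _ t ht i j k le_rfl)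

theorem compLinearMap_weightTriple_zero_three_six_ne_zero (hI : IsOpen I)
    (hF : IsCanonicalFrame γ I F θ) (hΩ0 : Ω ≠ 0) (hΩ : IsCompatible γ I Ω) (ht : t ∈ I) :
    Ω.compLinearMap (F t).mulVecLin (weightTriple 0 3 6) ≠ 0 := fun hl =>
  hΩ0 <| AlternatingMap.ext fun v => by
    have hv := DFunLike.congr_fun (hF.compLinearMap_eq_smul_invariantForm hI hΩ ht)
      fun i => (F t)⁻¹ *ᵥ v i
    rw [hl, zero_smul] at hv
    simpa [Matrix.mulVec_mulVec, Matrix.mul_nonsing_inv _ (hF.isUnit_det ht)] using hv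

theorem wilczynski_eq_zero_of_isCompatible (hI : IsOpen I) (hF : IsCanonicalFrame γ I F θ)
    (hΩ0 : Ω ≠ 0) (hΩ : IsCompatible γ I Ω) (ht : t ∈ I) {m : ℕ}
    (hm : m ∈ ({2, 3, 4, 6} : Finset ℕ)) : θ (m + 1) t = 0 := by
  let f (t : ℝ) := Ω.compLinearMap (F t).mulVecLin
  let l (t : ℝ) := f t (weightTriple 0 3 6)
  have hf {t} (ht : t ∈ I) : f t = l t • invariantForm :=
    hF.compLinearMap_eq_smul_invariantForm hI hΩ ht
  have hl : l t ≠ 0 := hF.compLinearMap_weightTriple_zero_three_six_ne_zero hI hΩ0 hΩ ht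
  obtain ⟨b, c, hderiv⟩ := hF.exists_hasDerivAt_formAction (Ω := Ω) ht
  have hA (u) : (l t • formAction invariantForm u) (canonicalMatrix b c (θ · t)) =
      formAction (f t) (weightTriple 0 3 6) (canonicalMatrix b c (θ · t)) * invariantForm u := by
    rw [← formAction_smul, ← hf ht]
    refine (hderiv u).unique (((hderiv (weightTriple 0 3 6)).mul_const _).congr_of_eventuallyEq ?_)
    exact Filter.eventually_of_mem (hI.mem_nhds ht) fun s hs => DFunLike.congr_fun (hf hs) u
  have hm26 : 2 ≤ m ∧ m ≤ 6 := by fin_cases hm <;> decide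
  refine (coeff_eq_zero_of_formAction_sl2X_eq (g := 0) (m := m)
    (Finset.mem_insert_of_mem hm) fun i j k hw => ?_)
  have h := hA (weightTriple i j k)
  rw [invariantForm_weightTriple_eq_zero (by omega), mul_zero, LinearMap.smul_apply, smul_eq_mul,
    formAction_invariantForm_canonicalMatrix_of_weight hm26.1 hm26.2 hw] at h
  rw [(mul_eq_zero.1 h).resolve_left hl, formAction_apply]
  simp

theorem compLinearMap_inv_eq (hI : IsOpen I) (hIc : IsPreconnected I)
    (hF : IsCanonicalFrame γ I F θ)
    (hA : ∀ t ∈ I, ∀ b c u, formAction Ω u (canonicalMatrix b c fun m => θ m t) = 0)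
    {s : ℝ} (hs : s ∈ I) (ht : t ∈ I) :
    Ω.compLinearMap (F s)⁻¹.mulVecLin = Ω.compLinearMap (F t)⁻¹.mulVecLin := by
  ext v
  have hderiv (t) (ht : t ∈ I) : HasDerivAt (fun s => Ω fun i => (F s)⁻¹ *ᵥ v i) 0 t := by
    obtain ⟨b, c, hFt⟩ := hF.hasDerivAt ht
    have hu : IsUnit (F t) := (Matrix.isUnit_iff_isUnit_det _).2 (hF.isUnit_det ht)
    simpa only [hA t ht b c, neg_zero] using hasDerivAt_form_nonsing_inv_mulVec Ω v hFt hu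
  exact hI.is_const_of_deriv_eq_zero hIc
    (fun t ht => (hderiv t ht).differentiableAt.differentiableWithinAt)
    (fun t ht => (hderiv t ht).deriv) hs ht

theorem exists_isG2Structure_isCompatible (hI : IsOpen I) (hIc : IsPreconnected I)
    (hF : IsCanonicalFrame γ I F θ)
    (hA : ∀ t ∈ I, ∀ b c u, formAction invariantForm u (canonicalMatrix b c fun m => θ m t) = 0) :
    ∃ Ω, IsG2Structure Ω ∧ IsCompatible γ I Ω := by
  obtain rfl | ⟨t₀, ht₀⟩ := I.eq_empty_or_nonempty
  · exact ⟨invariantForm, ⟨imSplitOctEquiv, rfl⟩, fun t ht => absurd ht (Set.notMem_empty t)⟩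
  let ψ : (Fin 7 → ℝ) ≃ₗ[ℝ] (Fin 7 → ℝ) := Matrix.toLin'OfInv
    (Matrix.mul_nonsing_inv _ (hF.isUnit_det ht₀)) (Matrix.nonsing_inv_mul _ (hF.isUnit_det ht₀))
  refine ⟨invariantForm.compLinearMap (F t₀)⁻¹.mulVecLin,
    ⟨ψ.trans imSplitOctEquiv, AlternatingMap.ext fun _ => rfl⟩,
    (hF.isCompatible_iff hI).2 fun t ht w => ?_⟩
  have hFt (u) : (F t)⁻¹ *ᵥ F t *ᵥ u = u := by
    rw [Matrix.mulVec_mulVec, Matrix.nonsing_inv_mul _ (hF.isUnit_det ht), Matrix.one_mulVec]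
  rw [hF.compLinearMap_inv_eq hI hIc hA ht₀ ht]
  have hcomp : (F t)⁻¹.mulVecLin ∘ ![F t *ᵥ weightVector 0, F t *ᵥ weightVector 1, w] =
      ![weightVector 0, weightVector 1, (F t)⁻¹ *ᵥ w] := by
    ext1 i
    fin_cases i
    exacts [hFt _, hFt _, rfl]
  refine (congrArg invariantForm hcomp).trans ?_
  simp [invariantForm_apply, weightVector]

end IsCanonicalFrame

end MovingFrames

theorem mainTheorem4 (I : Set ℝ) (hIo : IsOpen I) (hIc : IsPreconnected I)
    (γ : ℝ → ℙ ℝ (Fin 7 → ℝ)) (hγ : IsNondegenerateCurve γ I) :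
    (∃ θ : ℕ → ℝ → ℝ, IsWilczynskiInvariants γ I θ) ∧
    ∀ θ : ℕ → ℝ → ℝ, IsWilczynskiInvariants γ I θ →
      ((∃ Ω : (Fin 7 → ℝ) [⋀^Fin 3]→ₗ[ℝ] ℝ, IsG2Structure Ω ∧ IsCompatible γ I Ω) ↔
        ∀ i ∈ Finset.Icc 3 7, i ≠ 6 → ∀ t ∈ I, θ i t = 0) := by
  refine ⟨?_, ?_⟩
  · obtain ⟨F, θ, hF⟩ := exists_isCanonicalFrame hIo hγ
    exact ⟨θ, F, hF⟩
  · rintro θ ⟨F, hF⟩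
    refine ⟨?_, fun h => ?_⟩
    · rintro ⟨Ω, hΩ, hc⟩ i hi hi6 t ht
      obtain ⟨m, rfl⟩ : ∃ m, i = m + 1 := Nat.exists_eq_add_one.2 (by grind)
      have hm : m ∈ ({2, 3, 4, 6} : Finset ℕ) := by grind
      exact hF.wilczynski_eq_zero_of_isCompatible hIo hΩ.ne_zero hc ht hm
    · exact hF.exists_isG2Structure_isCompatible hIo hIc fun t ht b c =>
        formAction_invariantForm_canonicalMatrix_eq_zero (h 3 (by decide) (by decide) t ht)
          (h 4 (by decide) (by decide) t ht) (h 5 (by decide) (by decide) t ht)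
          (h 7 (by decide) (by decide) t ht)
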